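/- For a finite graph $G$ with $n\ge 2$ vertices whose adjacency matrix has eigenvalues $\lambda_1\ge\lambda_2\ge\dots\ge\lambda_n$, put $\lambda(G)=\max\{\lambda_2,-\lambda_n\}$. Let $\rho$ be the graph metric of $G$. The polygraph $G_{[1,2,3]}$ is the graph with vertex set $V(G)^3$ in which $(x_1,x_2,x_3)$ and $(y_1,y_2,y_3)$ are adjacent if and only if $[\rho(x_1,y_1),\rho(x_2,y_2),\rho(x_3,y_3)]=[1,2,3]$ as multisets. The clique complex of a graph $H$ is the simplicial complex whose faces are the nonempty finite sets of vertices that span a clique in $H$; its $2$-faces are the triangles of $H$. A finite simplicial complex $X$ has the $\alpha$-geometric overlap property if for every embedding (injective map) $V(X)\to\mathbb{R}^2$, extended affinely to the faces, there is a point of $\mathbb{R}^2$ that lies in the images of at least an $\alpha$-fraction of the $2$-faces of $X$. Theorem. There are absolute constants $d_0,\epsilon_0,\alpha_0>0$ such that, for every finite $d$-regular graph $G$ with girth larger than $9$, $d>d_0$ and $\lambda(G)<\epsilon_0 d$, the clique complex of $G_{[1,2,3]}$ has the $\alpha_0$-geometric overlap property. Explicitly, this holds with $d_0=1600$, $\epsilon_0=1/20$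 and $\alpha_0=1/100$. -/

import Mathlib

/-- `λ(G) = max {λ₂, -λₙ}`, where `λ₁ ≥ λ₂ ≥ ⋯ ≥ λₙ` are the eigenvalues (with multiplicity) of
the adjacency matrix of a finite graph `G` with `n ≥ 2` vertices; `eigenvalues₀` lists them in
decreasing order, starting with index `0`. (For `n ≤ 1`, where `λ₂` does not exist, it is `0`.) -/
noncomputable def secondEigenvalue {V : Type*} [Fintype V] [DecidableEq V]
    (G : SimpleGraph V) [DecidableRel G.Adj] : ℝ :=
  if h : 2 ≤ Fintype.card V then
    max ((G.isHermitian_adjMatrix ℝ).eigenvalues₀ ⟨1, by omega⟩)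
      (-(G.isHermitian_adjMatrix ℝ).eigenvalues₀ ⟨Fintype.card V - 1, by omega⟩)
  else 0

/-- The polygraph `G_S`: its vertices are the `m`-tuples of vertices of `G`, where `m` is the size
of the multiset `S`; distinct `x`, `y` are neighbors iff the multiset of the distances
`ρ(x i, y i)` is `S`. Distances are taken in `ℕ∞` (infinite between different components). -/
noncomputable def polygraph {V : Type*} (G : SimpleGraph V) (S : Multiset ℕ) :
    SimpleGraph (Fin (Multiset.card S) → V) where
  Adj x y := x ≠ y ∧
    (Finset.univ : Finset (Fin (Multiset.card S))).val.map (fun i => G.edist (x i) (y i)) =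
      S.map (fun k => (k : ℕ∞))
  symm := ⟨fun x y h => ⟨h.1.symm, by simpa only [SimpleGraph.edist_comm] using h.2⟩⟩
  loopless := ⟨fun _ h => h.1 rfl⟩

/-- The clique complex of a graph: its faces are the nonempty finite sets of vertices that span
a clique. -/
def cliqueComplex {W : Type*} (H : SimpleGraph W) : AbstractSimplicialComplex W where
  faces := {s | s.Nonempty ∧ H.IsClique (s : Set W)}
  isRelLowerSet_faces := by
    intro s hs
    refine ⟨hs.1, fun t hts ht => ⟨ht, ?_⟩⟩
    exact hs.2.subset (Finset.coe_subset.mpr hts)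
  singleton_mem := by
    intro v
    exact ⟨Finset.singleton_nonempty v, by simp⟩

/-- The set of `2`-faces (faces with three vertices) of a simplicial complex. -/
def twoFaces {W : Type*} (X : AbstractSimplicialComplex W) : Set (Finset W) :=
  {s | s ∈ X.faces ∧ s.card = 3}

/-- The `α`-geometric overlap property of a finite simplicial complex `X`: for every embedding
of the vertices into the plane, extended affinely to the faces, some point of the plane lies in
the images of at least an `α`-fraction of the `2`-faces of `X`. -/
def HasGeometricOverlap {W : Type*} [Finite W] (X : AbstractSimplicialComplex W) (α : ℝ) : Prop :=
  ∀ f : W → EuclideanSpace ℝ (Fin 2), Function.Injective f →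
    ∃ p : EuclideanSpace ℝ (Fin 2),
      α * ((twoFaces X).ncard : ℝ) ≤
        ({s | s ∈ twoFaces X ∧ p ∈ convexHull ℝ (f '' (s : Set W))}.ncard : ℝ)

/-! Write n for the number of vertices of G and N = n³. Three ingredients are compared: a planar
partition, a lower bound for triangles of the polygraph between large vertex sets, and an upper
bound for all triangles.

Plane. Three concurrent lines through a suitable point p cut the points into six sectors `S₁`, …,
`S₆` in cyclic order, and every triangle with vertices in alternate sectors contains p. An exact
equipartition is not needed: it suffices that `S₁` and `S₄` have about N/6 points and that `S₃`,
`S₅` have equal size, as do `S₂`, `S₆`, with the two sizes adding up to about N/3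
(`exists_six_sectors`).

Lower bound. Take a center in V³ and three end points whose coordinatewise distances to it are
(1,2,0), (1,1,1), (2,0,1). If no short path backtracks, the distances between any two ends are 1, 2,
3 in some order, so the ends form a triangle. Weighted tripods are a sum over centers of f·g·h, each
factor being a tensor product of powers of the normalized adjacency matrix K applied to an
indicator. The spectral gap makes K nearly averaging, except where a leg is 0: there f and h stay
close to one-coordinate marginals. Those marginals live on different coordinates, so the main term
is still the product of the densities (`sum_tensorApply_mul_ge`). Summing over the 6 coordinate
permutations keeps the marginal variances small, and over the 6 assignments of ends to sets gives
the factor 36, since no triangle is obtained twice. Degenerate tripods weigh less by a factor of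
order 1/d (`polygraph_triangles_ge`).

Upper bound. Girth above 9 forces the three distances in each coordinate to have even sum. Only 48
patterns survive, each coming from a tripod of total leg length 9, so there are at most 48·N·d⁹
ordered triangles (`card_polygraphTriangles_le`), hence at most 8·N·d⁹ faces. The two alternate
families give at least 0.08·N·d⁹ faces through p, a fraction 1/100. -/

set_option linter.unusedSectionVars false

open Matrix

/-! ### Planar geometry: six sectors around a point -/

/-- A finite set has a subset of any smaller size that is initial with respect to `key`. -/
theorem Finset.exists_initial_subset {W : Type*} (key : W → ℝ) (Q : Finset W) :
    ∀ j ≤ Q.card, ∃ L ⊆ Q, L.card = j ∧ ∀ l ∈ L, ∀ h ∈ Q, h ∉ L → key l ≤ key h := by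
  classical
  intro j
  induction j with
  | zero => intro _; exact ⟨∅, by simp, by simp, by simp⟩
  | succ j ih =>
    intro hj
    obtain ⟨L, hLQ, hLc, hL⟩ := ih (by omega)
    have hne : (Q \ L).Nonempty := by
      rw [← Finset.card_pos, Finset.card_sdiff_of_subset hLQ]; omega
    obtain ⟨q, hq, hmin⟩ := Finset.exists_min_image (Q \ L) key hne
    rw [Finset.mem_sdiff] at hq
    refine ⟨insert q L, Finset.insert_subset hq.1 hLQ, by
      rw [Finset.card_insert_of_notMem hq.2, hLc], ?_⟩
    intro l hl h hh hhn
    rw [Finset.mem_insert, not_or] at hhn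
    rcases Finset.mem_insert.1 hl with rfl | hl
    · exact hmin h (Finset.mem_sdiff.2 ⟨hh, hhn.2⟩)
    · exact hL l hl h hh hhn.2

/-- The `j`-th smallest value of a function on a finite set. -/
noncomputable def orderStatistic {W : Type*} (key : W → ℝ) (Q : Finset W) (j : ℕ)
    (hj : 0 < j) (hQ : j ≤ Q.card) : ℝ :=
  (Q.powersetCard j).attach.inf'
    (Finset.attach_nonempty_iff.2 (Finset.powersetCard_nonempty.2 hQ))
    fun L => L.1.sup' (Finset.card_pos.1 (by rw [(Finset.mem_powersetCard.1 L.2).2]; exact hj)) key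

theorem orderStatistic_continuous {W : Type*} (key : ℝ → W → ℝ)
    (hkey : ∀ w, Continuous fun t => key t w) (Q : Finset W) (j : ℕ)
    (hj : 0 < j) (hQ : j ≤ Q.card) :
    Continuous fun t => orderStatistic (key t) Q j hj hQ := by
  unfold orderStatistic
  exact Continuous.finset_inf'_apply _ fun L _ =>
    Continuous.finset_sup'_apply _ fun w _ => hkey w

theorem orderStatistic_le {W : Type*} (key : W → ℝ) (Q : Finset W) (j : ℕ)
    (hj : 0 < j) (hQ : j ≤ Q.card) (c : ℝ) (h : ∀ q ∈ Q, key q ≤ c) :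
    orderStatistic key Q j hj hQ ≤ c := by
  obtain ⟨L, hL⟩ := Finset.powersetCard_nonempty.2 hQ
  refine (Finset.inf'_le _ (Finset.mem_attach _ ⟨L, hL⟩)).trans (Finset.sup'_le _ _ ?_)
  exact fun q hq => h q ((Finset.mem_powersetCard.1 hL).1 hq)

theorem le_orderStatistic {W : Type*} (key : W → ℝ) (Q : Finset W) (j : ℕ)
    (hj : 0 < j) (hQ : j ≤ Q.card) (c : ℝ) (h : ∀ q ∈ Q, c ≤ key q) :
    c ≤ orderStatistic key Q j hj hQ := by
  refine Finset.le_inf' _ _ fun L _ => ?_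
  have hL := Finset.mem_powersetCard.1 L.2
  obtain ⟨q, hq⟩ := Finset.card_pos.1 (by rw [hL.2]; exact hj)
  exact (h q (hL.1 hq)).trans (Finset.le_sup' key hq)

/-- The `j`-th smallest value separates `j` lowest elements from the others. -/
theorem exists_subset_orderStatistic {W : Type*} (key : W → ℝ) (Q : Finset W) (j : ℕ)
    (hj : 0 < j) (hQ : j ≤ Q.card) :
    ∃ L ⊆ Q, L.card = j ∧ (∀ l ∈ L, key l ≤ orderStatistic key Q j hj hQ) ∧
      ∀ h ∈ Q, h ∉ L → orderStatistic key Q j hj hQ ≤ key h := by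
  obtain ⟨L, hLQ, hLc, hL⟩ := Q.exists_initial_subset key j hQ
  refine ⟨L, hLQ, hLc, fun l hl => ?_, fun h hh hhn => ?_⟩
  · refine Finset.le_inf' _ _ fun M _ => ?_
    have hM := Finset.mem_powersetCard.1 M.2
    by_cases hlM : l ∈ M.1
    · exact Finset.le_sup' key hlM
    · obtain ⟨q, hq, hqL⟩ : ∃ q ∈ M.1, q ∉ L := by
        by_contra! hcon
        have := Finset.eq_of_subset_of_card_le hcon (by rw [hM.2, hLc])
        exact hlM (this ▸ hl)
      exact (hL l hl q (hM.1 hq) hqL).trans (Finset.le_sup' key hq)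
  · have hLm : L ∈ Q.powersetCard j := Finset.mem_powersetCard.2 ⟨hLQ, hLc⟩
    refine (Finset.inf'_le _ (Finset.mem_attach _ ⟨L, hLm⟩)).trans (Finset.sup'_le _ _ ?_)
    exact fun q hq => hL q hq h hh hhn

/-- Two finite sets, one above the other, can be cut in prescribed proportions by one line
`x - t * y = m`. -/
theorem exists_common_cut {W : Type*} (x y : W → ℝ) (U D : Finset W) (y₀ : ℝ)
    (hsep : ∀ u ∈ U, ∀ v ∈ D, y v < y u)
    (i j : ℕ) (hi : 0 < i) (hiU : i ≤ U.card) (hj : 0 < j) (hjD : j ≤ D.card) :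
    ∃ t m : ℝ, (∃ L ⊆ U, L.card = i ∧ (∀ w ∈ L, x w - t * (y w - y₀) ≤ m) ∧
        ∀ w ∈ U, w ∉ L → m ≤ x w - t * (y w - y₀)) ∧
      ∃ L ⊆ D, L.card = j ∧ (∀ w ∈ L, x w - t * (y w - y₀) ≤ m) ∧
        ∀ w ∈ D, w ∉ L → m ≤ x w - t * (y w - y₀) := by
  set key : ℝ → W → ℝ := fun t w => x w - t * (y w - y₀) with hkey
  have hcont : ∀ w, Continuous fun t => key t w := fun w => by simp only [hkey]; fun_prop
  set qU : ℝ → ℝ := fun t => orderStatistic (key t) U i hi hiU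
  set qD : ℝ → ℝ := fun t => orderStatistic (key t) D j hj hjD
  have hUne : U.Nonempty := Finset.card_pos.1 (by omega)
  have hDne : D.Nonempty := Finset.card_pos.1 (by omega)
  set slope : W × W → ℝ := fun p => (x p.1 - x p.2) / (y p.1 - y p.2)
  have hsl : ∀ u ∈ U, ∀ v ∈ D, slope (u, v) * (y u - y v) = x u - x v := fun u hu v hv => by
    have := hsep u hu v hv
    exact div_mul_cancel₀ _ (by linarith)
  have hP : (U ×ˢ D).Nonempty := hUne.product hDne
  -- For t above all the ratios Δx/Δy between U and D, every point of U precedes every point of D in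
  -- the order of keys; for t below them all, the order is reversed. The two order statistics
  -- therefore agree for some t in between.
  have hhigh : qU ((U ×ˢ D).sup' hP slope) ≤ qD ((U ×ˢ D).sup' hP slope) := by
    set T := (U ×ˢ D).sup' hP slope
    have hT : ∀ u ∈ U, ∀ v ∈ D, key T u ≤ key T v := fun u hu v hv => by
      have h1 : slope (u, v) ≤ T := Finset.le_sup' slope (Finset.mk_mem_product hu hv)
      have h2 := hsl u hu v hv
      have h3 := hsep u hu v hv
      simp only [hkey]
      nlinarith
    refine (orderStatistic_le _ _ _ _ _ (U.sup' hUne (key T))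
      fun q hq => Finset.le_sup' _ hq).trans (le_orderStatistic _ _ _ _ _ _ fun v hv => ?_)
    exact Finset.sup'_le _ _ fun u hu => hT u hu v hv
  have hlow : qD ((U ×ˢ D).inf' hP slope) ≤ qU ((U ×ˢ D).inf' hP slope) := by
    set T := (U ×ˢ D).inf' hP slope
    have hT : ∀ u ∈ U, ∀ v ∈ D, key T v ≤ key T u := fun u hu v hv => by
      have h1 : T ≤ slope (u, v) := Finset.inf'_le slope (Finset.mk_mem_product hu hv)
      have h2 := hsl u hu v hv
      have h3 := hsep u hu v hv
      simp only [hkey]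
      nlinarith
    refine (orderStatistic_le _ _ _ _ _ (D.sup' hDne (key T))
      fun q hq => Finset.le_sup' _ hq).trans (le_orderStatistic _ _ _ _ _ _ fun u hu => ?_)
    exact Finset.sup'_le _ _ fun v hv => hT u hu v hv
  obtain ⟨t, ht⟩ : ∃ t, qU t = qD t :=
    intermediate_value_univ₂ (orderStatistic_continuous key hcont U i hi hiU)
      (orderStatistic_continuous key hcont D j hj hjD) hhigh hlow
  obtain ⟨L, h1, h2, h3, h4⟩ := exists_subset_orderStatistic (key t) U i hi hiU
  obtain ⟨M, k1, k2, k3, k4⟩ := exists_subset_orderStatistic (key t) D j hj hjD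
  refine ⟨t, qU t, ⟨L, h1, h2, h3, h4⟩, ⟨M, k1, k2, ?_, ?_⟩⟩
  · rw [ht]; exact k3
  · rw [ht]; exact k4

/-- Three vectors in the plane whose directions positively span: a nontrivial nonnegative
combination vanishes. -/
theorem exists_weights_of_sectors {a₁ a₂ c₁ c₂ e₁ e₂ : ℝ} (ha₁ : 0 ≤ a₁) (ha₂ : 0 ≤ a₂)
    (hc₁ : 0 ≤ c₁) (hc₂ : 0 ≤ c₂) (he₁ : 0 ≤ e₁) (he₂ : 0 ≤ e₂) (hce : c₁ * e₂ ≤ c₂ * e₁) :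
    ∃ α β γ : ℝ, 0 ≤ α ∧ 0 ≤ β ∧ 0 ≤ γ ∧ α + β + γ = 1 ∧
      α * a₁ + β * c₁ - γ * e₁ = 0 ∧ α * a₂ - β * c₂ + γ * e₂ = 0 := by
  -- The weights are, up to a common sign, the 2×2 minors of the two linear equations, i.e. the
  -- cross product of their rows. They only need normalizing unless all three vanish; that
  -- degenerate case is treated by hand.
  set α := c₂ * e₁ - c₁ * e₂ with hα
  set β := e₁ * a₂ + e₂ * a₁ with hβ
  set γ := a₁ * c₂ + a₂ * c₁ with hγ
  have hα0 : 0 ≤ α := by linarith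
  have hβ0 : 0 ≤ β := by positivity
  have hγ0 : 0 ≤ γ := by positivity
  rcases (add_nonneg (add_nonneg hα0 hβ0) hγ0).eq_or_lt with h0 | hpos
  · have hα1 : α = 0 := by linarith
    have hβ1 : β = 0 := by linarith
    have hγ1 : γ = 0 := by linarith
    have z1 : e₁ * a₂ = 0 := by nlinarith [mul_nonneg he₁ ha₂, mul_nonneg he₂ ha₁]
    have z2 : e₂ * a₁ = 0 := by nlinarith [mul_nonneg he₁ ha₂, mul_nonneg he₂ ha₁]
    have z3 : a₁ * c₂ = 0 := by nlinarith [mul_nonneg ha₁ hc₂, mul_nonneg ha₂ hc₁]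
    have z4 : a₂ * c₁ = 0 := by nlinarith [mul_nonneg ha₁ hc₂, mul_nonneg ha₂ hc₁]
    rcases ha₁.eq_or_lt with ha | ha
    · rcases ha₂.eq_or_lt with ha' | ha'
      · exact ⟨1, 0, 0, by norm_num, le_rfl, le_rfl, by norm_num, by simp [← ha], by simp [← ha']⟩
      · have y1 : e₁ = 0 := by simpa [ha'.ne'] using z1
        have y2 : c₁ = 0 := by simpa [ha'.ne'] using z4
        rcases (add_nonneg hc₂ he₂).eq_or_lt with h | h
        · exact ⟨0, 1, 0, le_rfl, by norm_num, le_rfl, by norm_num, by simp [y2],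
            by rw [show c₂ = 0 by linarith]; simp⟩
        · refine ⟨0, e₂ / (c₂ + e₂), c₂ / (c₂ + e₂), le_rfl, by positivity, by positivity, ?_, ?_, ?_⟩
          · field_simp; ring
          · simp [y1, y2]
          · field_simp; ring
    · have y1 : e₂ = 0 := by simpa [ha.ne'] using z2
      have y2 : c₂ = 0 := by simpa [ha.ne'] using z3
      rcases (add_nonneg hc₁ he₁).eq_or_lt with h | h
      · exact ⟨0, 1, 0, le_rfl, by norm_num, le_rfl, by norm_num,
          by rw [show c₁ = 0 by linarith]; simp, by simp [y2]⟩
      · refine ⟨0, e₁ / (c₁ + e₁), c₁ / (c₁ + e₁), le_rfl, by positivity, by positivity, ?_, ?_, ?_⟩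
        · field_simp; ring
        · field_simp; ring
        · simp [y1, y2]
  · refine ⟨α / (α + β + γ), β / (α + β + γ), γ / (α + β + γ), by positivity, by positivity,
      by positivity, by field_simp, ?_, ?_⟩
    · field_simp
      rw [hα, hβ, hγ]; ring
    · field_simp
      rw [hα, hβ, hγ]; ring

/-- A linear functional `v + s * u` that is injective on finitely many points. -/
theorem exists_injective_shear {W : Type*} [Finite W] (u v : W → ℝ)
    (h : Function.Injective fun w => (u w, v w)) :
    ∃ s : ℝ, Function.Injective fun w => v w + s * u w := by
  obtain ⟨s, hs⟩ := (Set.finite_range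
    fun p : W × W => (v p.2 - v p.1) / (u p.1 - u p.2)).exists_notMem
  refine ⟨s, fun a b hab => ?_⟩
  by_contra hne
  have hab' : v a + s * u a = v b + s * u b := hab
  by_cases hu : u a = u b
  · exact hne (h (Prod.ext hu (by rw [hu] at hab'; simpa using hab')))
  · refine hs ⟨(a, b), ?_⟩
    have : u a - u b ≠ 0 := sub_ne_zero.2 hu
    change (v b - v a) / (u a - u b) = s
    rw [div_eq_iff this]; linarith

theorem mul_le_mul_of_slope_le {c₁ c₂ e₁ e₂ : ℝ} (hc₁ : 0 ≤ c₁) (hc₂ : 0 ≤ c₂) (he₁ : 0 ≤ e₁)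
    (he₂ : 0 ≤ e₂) (h : c₁ / (c₁ + c₂) ≤ e₁ / (e₁ + e₂)) : c₁ * e₂ ≤ c₂ * e₁ := by
  rcases (add_nonneg hc₁ hc₂).eq_or_lt with hc | hc
  · rw [show c₁ = 0 by linarith, show c₂ = 0 by linarith]; simp
  · rcases (add_nonneg he₁ he₂).eq_or_lt with he | he
    · rw [show e₁ = 0 by linarith, show e₂ = 0 by linarith]; simp
    · rw [div_le_div_iff₀ hc he] at h
      linarith

/-- Six disjoint sets of prescribed sizes around a point `p` of the plane such that the triangles
with vertices in the odd sets, and those with vertices in the even sets, contain `p`. -/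
theorem exists_six_sectors {W : Type*} [Fintype W] [DecidableEq W]
    (f : W → EuclideanSpace ℝ (Fin 2)) (hf : Function.Injective f) (k : ℕ) (hk : 0 < k)
    (hkN : 6 * k ≤ Fintype.card W) :
    ∃ (p : EuclideanSpace ℝ (Fin 2)) (S₁ S₂ S₃ S₄ S₅ S₆ : Finset W),
      S₁.card = k ∧ S₄.card = k ∧ S₂.card + S₃.card = 2 * k ∧ S₃.card + S₆.card = 2 * k ∧
      S₅.card + S₆.card = 2 * k ∧
      [S₁, S₂, S₃, S₄, S₅, S₆].Pairwise Disjoint ∧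
      (∀ a ∈ S₁, ∀ c ∈ S₃, ∀ e ∈ S₅, p ∈ convexHull ℝ {f a, f c, f e}) ∧
      (∀ a ∈ S₄, ∀ c ∈ S₂, ∀ e ∈ S₆, p ∈ convexHull ℝ {f a, f c, f e}) := by
  -- After a shear all heights are distinct, so the lower 3k points are strictly separated from the
  -- chosen upper ones.
  obtain ⟨s, hs⟩ := exists_injective_shear (fun w => f w 0) (fun w => f w 1) (by
    intro a b hab
    apply hf
    ext i
    fin_cases i
    · exact congrArg Prod.fst hab
    · exact congrArg Prod.snd hab)
  set x : W → ℝ := fun w => f w 0 with hx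
  set y : W → ℝ := fun w => f w 1 + s * f w 0 with hy
  obtain ⟨D, -, hDc, hD⟩ := (Finset.univ : Finset W).exists_initial_subset y (3 * k) (by
    rw [Finset.card_univ]; omega)
  obtain ⟨U, hUD, hUc⟩ := Finset.exists_subset_card_eq (s := Finset.univ \ D) (n := 3 * k) (by
    rw [Finset.card_sdiff_of_subset (Finset.subset_univ _), Finset.card_univ]; omega)
  have hUD' : ∀ u ∈ U, u ∉ D := fun u hu => (Finset.mem_sdiff.1 (hUD hu)).2
  have hsep : ∀ u ∈ U, ∀ v ∈ D, y v < y u := fun u hu v hv =>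
    lt_of_le_of_ne (hD v hv u (Finset.mem_univ _) (hUD' u hu)) fun h =>
      hUD' u hu (hs h ▸ hv)
  obtain ⟨y₀, hy₀D, hy₀U⟩ : ∃ y₀, (∀ v ∈ D, y v ≤ y₀) ∧ ∀ u ∈ U, y₀ ≤ y u := by
    have hne : D.Nonempty := Finset.card_pos.1 (by omega)
    exact ⟨D.sup' hne y, fun v hv => Finset.le_sup' y hv, fun u hu =>
      Finset.sup'_le _ _ fun v hv => (hsep u hu v hv).le⟩
  -- The cut is 2k : k above and k : 2k below. The quadrants of size k are the sectors `S₁` and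
  -- `S₄`; the opposite quadrants of size 2k are still to be split.
  obtain ⟨t, m, ⟨Ul, hUl, hUlc, hUl1, hUl2⟩, ⟨Dl, hDl, hDlc, hDl1, hDl2⟩⟩ :=
    exists_common_cut x y U D y₀ hsep (2 * k) k (by omega) (by omega) (by omega) (by omega)
  set Y : W → ℝ := fun w => y w - y₀ with hY
  set M : W → ℝ := fun w => x w - t * (y w - y₀) - m with hM
  have hdUD : Disjoint U D := Finset.disjoint_left.2 hUD'
  have hdQ : Disjoint Ul (D \ Dl) := Finset.disjoint_of_subset_left hUl
    (Finset.disjoint_of_subset_right Finset.sdiff_subset hdUD)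
  have hDr : (D \ Dl).card = 2 * k := by rw [Finset.card_sdiff_of_subset hDl]; omega
  have hUr : (U \ Ul).card = k := by rw [Finset.card_sdiff_of_subset hUl]; omega
  -- The third line through p is found by sorting both large quadrants together by steepness, on the
  -- scale |Y| / (|Y| + |M|), which avoids division by zero problems at M = 0. Taking the 2k
  -- flattest points makes the flat part of one quadrant as large as the steep part of the other.
  obtain ⟨Lo, hLoQ, hLoc, hLo⟩ := (Ul ∪ (D \ Dl)).exists_initial_subset
    (fun w => |Y w| / (|Y w| + |M w|)) (2 * k) (by
      rw [Finset.card_union_of_disjoint hdQ]; omega)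
  -- The point where Y = M = 0, written in the original, unsheared coordinates.
  set p : EuclideanSpace ℝ (Fin 2) := !₂[m, y₀ - s * m] with hp
  have hull : ∀ a c e : W, ∀ α β γ : ℝ, 0 ≤ α → 0 ≤ β → 0 ≤ γ → α + β + γ = 1 →
      α * Y a + β * Y c + γ * Y e = 0 → α * M a + β * M c + γ * M e = 0 →
      p ∈ convexHull ℝ {f a, f c, f e} := by
    intro a c e α β γ hα hβ hγ hsum h1 h2
    have hx' : α * f a 0 + β * f c 0 + γ * f e 0 = m := by
      simp only [hM, hY, hx] at h1 h2
      linear_combination h2 + t * h1 + m * hsum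
    have hy' : α * f a 1 + β * f c 1 + γ * f e 1 = y₀ - s * m := by
      simp only [hY, hy] at h1
      linear_combination h1 - s * hx' + y₀ * hsum
    have : p = α • f a + β • f c + γ • f e := by
      ext i
      fin_cases i
      · simp [hp, ← hx']
      · simp [hp, ← hy']
    rw [this]
    have hconv := convex_convexHull ℝ ({f a, f c, f e} : Set (EuclideanSpace ℝ (Fin 2)))
    have := hconv.sum_mem (t := Finset.univ) (w := ![α, β, γ]) (z := ![f a, f c, f e])
      (by intro i _; fin_cases i <;> simpa) (by simp [Fin.sum_univ_three, hsum])
      (by intro i _; fin_cases i <;> exact subset_convexHull ℝ _ (by simp))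
    simpa [Fin.sum_univ_three] using this
  have sU : ∀ w ∈ U, 0 ≤ Y w := fun w hw => sub_nonneg.2 (hy₀U w hw)
  have sD : ∀ w ∈ D, Y w ≤ 0 := fun w hw => sub_nonpos.2 (hy₀D w hw)
  have sUl : ∀ w ∈ Ul, M w ≤ 0 := fun w hw => sub_nonpos.2 (hUl1 w hw)
  have sUr : ∀ w ∈ U \ Ul, 0 ≤ M w := fun w hw => by
    rw [Finset.mem_sdiff] at hw
    exact sub_nonneg.2 (hUl2 w hw.1 hw.2)
  have sDl : ∀ w ∈ Dl, M w ≤ 0 := fun w hw => sub_nonpos.2 (hDl1 w hw)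
  have sDr : ∀ w ∈ D \ Dl, 0 ≤ M w := fun w hw => by
    rw [Finset.mem_sdiff] at hw
    exact sub_nonneg.2 (hDl2 w hw.1 hw.2)
  have hLo2 : (Ul ∩ Lo).card + ((D \ Dl) ∩ Lo).card = 2 * k := by
    rw [← Finset.card_union_of_disjoint (Finset.disjoint_of_subset_left Finset.inter_subset_left
      (Finset.disjoint_of_subset_right Finset.inter_subset_left hdQ)),
      ← Finset.union_inter_distrib_right, Finset.inter_eq_right.2 hLoQ, hLoc]
  have hUl3 : (Ul \ Lo).card + (Ul ∩ Lo).card = 2 * k := by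
    rw [Finset.card_sdiff_add_card_inter, hUlc]
  have hDr3 : ((D \ Dl) \ Lo).card + ((D \ Dl) ∩ Lo).card = 2 * k := by
    rw [Finset.card_sdiff_add_card_inter, hDr]
  refine ⟨p, U \ Ul, Ul \ Lo, Ul ∩ Lo, Dl, (D \ Dl) \ Lo, (D \ Dl) ∩ Lo, hUr, hDlc, hUl3,
    hLo2, hDr3, ?_, ?_, ?_⟩
  · have hUD'' : ∀ u ∈ Ul, u ∉ D := fun u hu => hUD' u (hUl hu)
    simp only [List.pairwise_cons, List.mem_cons, List.not_mem_nil, or_false, forall_eq_or_imp,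
      forall_eq, Finset.disjoint_left, Finset.mem_sdiff, Finset.mem_inter]
    refine ⟨⟨?_, ?_, ?_, ?_, ?_⟩, ⟨?_, ?_, ?_, ?_⟩, ⟨?_, ?_, ?_⟩, ⟨?_, ?_⟩, ?_, ?_, ?_⟩
    all_goals (intros; tauto)
  · intro a ha c hc e he
    have haU := (Finset.mem_sdiff.1 ha).1
    have hcU := (Finset.mem_inter.1 hc).1
    have heD := (Finset.mem_sdiff.1 he).1
    have heD' := (Finset.mem_sdiff.1 heD).1
    have key := hLo c (Finset.mem_inter.1 hc).2 e (Finset.mem_union_right _ heD)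
      (Finset.mem_sdiff.1 he).2
    simp only [abs_of_nonneg (sU c (hUl hcU)), abs_of_nonpos (sUl c hcU),
      abs_of_nonpos (sD e heD'), abs_of_nonneg (sDr e heD)] at key
    have h1 := sU c (hUl hcU)
    have h2 := neg_nonneg.2 (sUl c hcU)
    have h3 := neg_nonneg.2 (sD e heD')
    have h4 := sDr e heD
    obtain ⟨α, β, γ, p1, p2, p3, q, r1, r2⟩ := exists_weights_of_sectors (sU a haU) (sUr a ha)
      h1 h2 h3 h4 (mul_le_mul_of_slope_le h1 h2 h3 h4 key)
    exact hull a c e α β γ p1 p2 p3 q (by linarith) (by linarith)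
  · intro a ha c hc e he
    have haD := hDl ha
    have hcU := (Finset.mem_sdiff.1 hc).1
    have heD := (Finset.mem_inter.1 he).1
    have heD' := (Finset.mem_sdiff.1 heD).1
    have key := hLo e (Finset.mem_inter.1 he).2 c (Finset.mem_union_left _ hcU)
      (Finset.mem_sdiff.1 hc).2
    simp only [abs_of_nonneg (sU c (hUl hcU)), abs_of_nonpos (sUl c hcU),
      abs_of_nonpos (sD e heD'), abs_of_nonneg (sDr e heD)] at key
    have h1 := sU c (hUl hcU)
    have h2 := neg_nonneg.2 (sUl c hcU)
    have h3 := neg_nonneg.2 (sD e heD')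
    have h4 := sDr e heD
    obtain ⟨α, β, γ, p1, p2, p3, q, r1, r2⟩ := exists_weights_of_sectors
      (neg_nonneg.2 (sD a haD)) (neg_nonneg.2 (sDl a ha))
      h3 h4 h1 h2 (mul_le_mul_of_slope_le h3 h4 h1 h2 key)
    exact hull a c e α γ β p1 p3 p2 (by linarith) (by linarith) (by linarith)

/-! ### Short walks and distances in a graph of large girth -/

namespace SimpleGraph

section Girth

variable {V : Type*} {G : SimpleGraph V}

/-- A cycle inside `s` would be a cycle of `G` with at most as many edges as `s`. This lets facts
about forests be applied to the edges of short walks. -/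
theorem isAcyclic_fromEdgeSet_of_card_lt_egirth (s : Finset (Sym2 V))
    (hs : (s.card : ℕ∞) < G.egirth) (hsG : (s : Set (Sym2 V)) ⊆ G.edgeSet) :
    (fromEdgeSet (s : Set (Sym2 V))).IsAcyclic := by
  classical
  intro u c hc
  have hle : fromEdgeSet (s : Set (Sym2 V)) ≤ G := by
    intro a b hab
    exact hsG ((fromEdgeSet_adj _).1 hab).1
  have h1 : G.egirth ≤ (c.mapLe hle).length := egirth_le_length ((Walk.isCycle_mapLe hle).2 hc)
  have h2 : c.length ≤ s.card := by
    rw [← Walk.length_edges, ← List.toFinset_card_of_nodup hc.edges_nodup]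
    refine Finset.card_le_card fun e he => ?_
    have := c.edges_subset_edgeSet (List.mem_toFinset.1 he)
    rw [edgeSet_fromEdgeSet] at this
    exact this.1
  have h3 : (c.mapLe hle).length = c.length := by simp
  rw [h3] at h1
  exact absurd (hs.trans_le h1) (not_lt.2 (by exact_mod_cast h2))

/-- The edges of the walk span a forest, and a forest is bipartite. -/
theorem even_length_of_lt_egirth {u : V} (w : G.Walk u u) (hw : (w.length : ℕ∞) < G.egirth) :
    Even w.length := by
  classical
  have hac := isAcyclic_fromEdgeSet_of_card_lt_egirth (G := G) w.edges.toFinset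
    (lt_of_le_of_lt (by
      rw [← Walk.length_edges]; exact_mod_cast List.toFinset_card_le _) hw)
    (by intro e he; exact w.edges_subset_edgeSet (by simpa using he))
  have := two_colorable_iff_forall_loop_even.1 hac.colorable_two u (w.transfer _ (by
    intro e he
    rw [edgeSet_fromEdgeSet]
    exact ⟨by simpa using he, fun h => G.not_isDiag_of_mem_edgeSet (w.edges_subset_edgeSet he) h⟩))
  simpa using this

/-- Both paths live in the forest spanned by their edges, where paths are unique. -/
theorem path_unique_of_lt_egirth {u v : V} {p q : G.Walk u v} (hp : p.IsPath) (hq : q.IsPath)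
    (h : ((p.length + q.length : ℕ) : ℕ∞) < G.egirth) : p = q := by
  classical
  have hac := isAcyclic_fromEdgeSet_of_card_lt_egirth (G := G) (p.edges ++ q.edges).toFinset
    (lt_of_le_of_lt (by
      rw [← Walk.length_edges, ← Walk.length_edges, ← List.length_append]
      exact_mod_cast List.toFinset_card_le _) h)
    (by
      intro e he
      rcases List.mem_append.1 (List.mem_toFinset.1 (Finset.mem_coe.1 he)) with he | he
      · exact p.edges_subset_edgeSet he
      · exact q.edges_subset_edgeSet he)
  have hp' : ∀ e ∈ p.edges,
      e ∈ (fromEdgeSet ((p.edges ++ q.edges).toFinset : Set (Sym2 V))).edgeSet := by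
    intro e he
    rw [edgeSet_fromEdgeSet]
    exact ⟨by simpa using Or.inl he,
      fun h => G.not_isDiag_of_mem_edgeSet (p.edges_subset_edgeSet he) h⟩
  have hq' : ∀ e ∈ q.edges,
      e ∈ (fromEdgeSet ((p.edges ++ q.edges).toFinset : Set (Sym2 V))).edgeSet := by
    intro e he
    rw [edgeSet_fromEdgeSet]
    exact ⟨by simpa using Or.inr he,
      fun h => G.not_isDiag_of_mem_edgeSet (q.edges_subset_edgeSet he) h⟩
  have := (hac.subsingleton_path _ _).elim ⟨p.transfer _ hp', hp.transfer hp'⟩ ⟨q.transfer _ hq', hq.transfer hq'⟩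
  have h2 := congrArg Walk.support (congrArg Subtype.val this)
  simp only [Walk.support_transfer] at h2
  exact Walk.ext_support h2

variable (hg : 9 < G.egirth)
include hg

/-- A shortest path is no longer than `p`, so together they have at most 8 edges and must coincide.
-/
theorem edist_eq_length_of_isPath {u v : V} {p : G.Walk u v} (hp : p.IsPath)
    (hl : p.length ≤ 4) : G.edist u v = p.length := by
  have hr : G.Reachable u v := ⟨p⟩
  obtain ⟨q, hq, hql⟩ := hr.exists_path_of_dist
  have hle : q.length ≤ p.length := hql ▸ dist_le p
  have : p = q := path_unique_of_lt_egirth hp hq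
    (lt_of_le_of_lt (by exact_mod_cast (show p.length + q.length ≤ 9 by omega)) hg)
  rw [← hr.coe_dist_eq_edist, ← hql, this]

theorem not_triangle {a b c : V} (hab : G.Adj a b) (hbc : G.Adj b c) (hca : G.Adj c a) :
    False := by
  have := even_length_of_lt_egirth (.cons hab (.cons hbc (.cons hca .nil)))
    (lt_trans (by simp only [Walk.length_cons, Walk.length_nil]; norm_num) hg)
  simp at this
  revert this
  decide

theorem common_neighbor_unique {a b m m' : V} (hne : a ≠ b) (h1 : G.Adj a m) (h2 : G.Adj m b)
    (h3 : G.Adj a m') (h4 : G.Adj m' b) : m = m' := by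
  have hp : (Walk.cons h1 (.cons h2 .nil)).IsPath := by
    simp [Walk.isPath_def, h1.ne, h2.ne, hne]
  have hq : (Walk.cons h3 (.cons h4 .nil)).IsPath := by
    simp [Walk.isPath_def, h3.ne, h4.ne, hne]
  have := path_unique_of_lt_egirth hp hq
    (lt_trans (by simp only [Walk.length_cons, Walk.length_nil]; norm_num) hg)
  simpa using congrArg Walk.support this

theorem edist_eq_two {a m b : V} (h1 : G.Adj a m) (h2 : G.Adj m b) (hne : a ≠ b) :
    G.edist a b = 2 := by
  have hp : (Walk.cons h1 (.cons h2 .nil)).IsPath := by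
    simp [Walk.isPath_def, h1.ne, h2.ne, hne]
  rw [edist_eq_length_of_isPath hg hp (by simp)]
  simp

theorem edist_eq_three {a m n b : V} (h1 : G.Adj a m) (h2 : G.Adj m n) (h3 : G.Adj n b)
    (hn : a ≠ n) (hm : m ≠ b) : G.edist a b = 3 := by
  have hab : a ≠ b := by
    rintro rfl
    exact not_triangle hg h1 h2 h3
  have hp : (Walk.cons h1 (.cons h2 (.cons h3 .nil))).IsPath := by
    simp [Walk.isPath_def, h1.ne, h2.ne, h3.ne, hn, hm, hab]
  rw [edist_eq_length_of_isPath hg hp (by simp)]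
  simp

theorem even_of_edist_eq {u v w : V} {a b c : ℕ} (h1 : G.edist u v = a) (h2 : G.edist u w = b)
    (h3 : G.edist v w = c) (h : a + b + c ≤ 9) : Even (a + b + c) := by
  obtain ⟨p, hp⟩ := exists_walk_of_edist_eq_coe h1
  obtain ⟨q, hq⟩ := exists_walk_of_edist_eq_coe h2
  obtain ⟨r, hr⟩ := exists_walk_of_edist_eq_coe h3
  have hl : ((p.append r).append q.reverse).length = a + b + c := by
    simp [hp, hq, hr]; ring
  have := even_length_of_lt_egirth ((p.append r).append q.reverse)
    (lt_of_le_of_lt (by rw [hl]; exact_mod_cast h) hg)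
  rwa [hl] at this

/-- The one center that needs an argument in the upper bound: the legs 1, 1, 2. The common neighbor
of u and v must be the first step of a geodesic from u to w. -/
theorem exists_median {u v w : V} (huv : G.edist u v = 2) (huw : G.edist u w = 3)
    (hvw : G.edist v w = 3) :
    ∃ m, G.edist m u = 1 ∧ G.edist m v = 1 ∧ G.edist m w = 2 := by
  obtain ⟨hne, -, m, hm⟩ := edist_eq_two_iff.1 huv
  rw [mem_commonNeighbors] at hm
  obtain ⟨p, hp⟩ := exists_walk_of_edist_eq_coe (k := 3) huw
  match p, hp with
  | .cons (v := a) h1 (.cons (v := b) h2 (.cons h3 .nil)), _ =>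
    have haw : a ≠ w := by
      rintro rfl
      rw [edist_eq_one_iff_adj.2 h1] at huw
      norm_num at huw
    have hub : u ≠ b := by
      rintro rfl
      rw [edist_eq_one_iff_adj.2 h3] at huw
      norm_num at huw
    have haw2 : G.edist a w = 2 := edist_eq_two hg h2 h3 haw
    by_cases hma : m = a
    · subst hma
      exact ⟨m, edist_eq_one_iff_adj.2 h1.symm, edist_eq_one_iff_adj.2 hm.2.symm, haw2⟩
    -- Otherwise v, m, u, a, b, w is a path of length 5 next to a geodesic of length 3 from v to w,
    -- 8 edges in all.
    · exfalso
      have huw' : u ≠ w := by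
        rintro rfl
        simp at huw
      have hvw' : v ≠ w := by
        rintro rfl
        simp at hvw
      have hva : v ≠ a := by
        rintro rfl
        rw [hvw] at haw2
        norm_num at haw2
      have hvb : v ≠ b := by
        rintro rfl
        rw [edist_eq_one_iff_adj.2 h3] at hvw
        norm_num at hvw
      have hmb : m ≠ b := by
        rintro rfl
        exact not_triangle hg h1 h2 hm.1.symm
      have hmw : m ≠ w := by
        rintro rfl
        rw [edist_eq_one_iff_adj.2 hm.1] at huw
        norm_num at huw
      have hpath : (Walk.cons hm.2 (.cons hm.1.symm
          (.cons h1 (.cons h2 (.cons h3 .nil))))).IsPath := by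
        simp [Walk.isPath_def, h1.ne, h2.ne, h3.ne, hm.2.ne, hm.1.ne', hub, haw, hva, hvb, hmb,
          hmw, hvw', huw', hma, hne.symm]
      obtain ⟨q, hq⟩ := exists_walk_of_edist_eq_coe (k := 3) hvw
      have hqp : q.IsPath := by
        refine q.isPath_of_length_eq_dist ?_
        have := (Reachable.coe_dist_eq_edist ⟨q⟩).trans hvw
        rw [hq]
        exact_mod_cast this.symm
      have := congrArg Walk.length (path_unique_of_lt_egirth hpath hqp
        (lt_of_le_of_lt (by
          rw [hq]; simp only [Walk.length_cons, Walk.length_nil]; norm_num) hg))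
      rw [hq] at this
      simp at this

end Girth

end SimpleGraph

/-! ### Spectral gap of a regular graph -/

/-- A `d`-regular graph whose nontrivial eigenvalues are at most `c < d` in absolute value acts on
functions of mean zero with norm at most `c`. -/
theorem sum_sq_adjMatrix_mulVec_le {V : Type*} [Fintype V] [DecidableEq V]
    (G : SimpleGraph V) [DecidableRel G.Adj] (d : ℕ) (hreg : G.IsRegularOfDegree d)
    (hV : 2 ≤ Fintype.card V) (c : ℝ) (hc : secondEigenvalue G ≤ c) (hcd : c < d)
    (φ : V → ℝ) (hφ : ∑ v, φ v = 0) :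
    ∑ v, (G.adjMatrix ℝ *ᵥ φ) v ^ 2 ≤ c ^ 2 * ∑ v, φ v ^ 2 := by
  set hA := G.isHermitian_adjMatrix ℝ
  set M := G.adjMatrix ℝ with hM
  have hsymm : Mᵀ = M := G.transpose_adjMatrix
  rw [secondEigenvalue, dif_pos hV] at hc
  set ix : V ≃ Fin (Fintype.card V) := (Fintype.equivOfCardEq (Fintype.card_fin _)).symm
  have hev : ∀ i, hA.eigenvalues i = hA.eigenvalues₀ (ix i) := fun i => rfl
  have hanti := hA.eigenvalues₀_antitone
  -- The index carrying the largest eigenvalue; all others are bounded by `c` in absolute value.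
  set z : V := ix.symm ⟨0, by omega⟩ with hz
  have habs : ∀ i, i ≠ z → |hA.eigenvalues i| ≤ c := by
    intro i hi
    have hne : (ix i).1 ≠ 0 := by
      intro h
      apply hi
      rw [hz, Equiv.eq_symm_apply]
      exact Fin.ext h
    rw [hev, abs_le]
    constructor
    · have h1 : hA.eigenvalues₀ ⟨Fintype.card V - 1, by omega⟩ ≤ hA.eigenvalues₀ (ix i) :=
        hanti (Fin.le_def.2 (by have := (ix i).2; simp only; omega))
      have h2 := (le_max_right _ _).trans hc
      linarith
    · have h1 : hA.eigenvalues₀ (ix i) ≤ hA.eigenvalues₀ ⟨1, by omega⟩ :=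
        hanti (Fin.le_def.2 (by simp only; omega))
      have h2 := (le_max_left _ _).trans hc
      linarith
  set b := hA.eigenvectorBasis with hb
  have hinner : ∀ (i : V) (ψ : V → ℝ), inner ℝ (b i) (WithLp.toLp 2 ψ) = (b i : V → ℝ) ⬝ᵥ ψ := by
    intro i ψ
    rw [EuclideanSpace.inner_eq_star_dotProduct, dotProduct_comm]
    simp
  have hinnerM : ∀ (i : V) (ψ : V → ℝ),
      (b i : V → ℝ) ⬝ᵥ (M *ᵥ ψ) = hA.eigenvalues i * ((b i : V → ℝ) ⬝ᵥ ψ) := by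
    intro i ψ
    rw [dotProduct_mulVec, ← mulVec_transpose, hsymm, hA.mulVec_eigenvectorBasis, smul_dotProduct,
      smul_eq_mul]
  have hparseval : ∀ ψ : V → ℝ, ∑ v, ψ v ^ 2 = ∑ i, ((b i : V → ℝ) ⬝ᵥ ψ) ^ 2 := by
    intro ψ
    have := b.sum_sq_norm_inner_right (WithLp.toLp 2 ψ)
    rw [EuclideanSpace.norm_sq_eq] at this
    simp only [hinner, Real.norm_eq_abs, sq_abs] at this
    exact this.symm
  have hone : M *ᵥ (fun _ => (1 : ℝ)) = fun _ => (d : ℝ) := by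
    ext v
    rw [hM, SimpleGraph.adjMatrix_mulVec_apply]
    simp [hreg v]
  -- Constants are an eigenvector for `d`, and the eigenvalues other than the one at z are at most c
  -- < d. Connectedness thus need not be assumed.
  have horth : ∀ i, i ≠ z → (b i : V → ℝ) ⬝ᵥ (fun _ => (1 : ℝ)) = 0 := by
    intro i hi
    have h1 := hinnerM i (fun _ => 1)
    rw [hone, show (fun _ : V => (d : ℝ)) = (d : ℝ) • (fun _ : V => (1 : ℝ)) by ext; simp,
      dotProduct_smul, smul_eq_mul] at h1
    have h2 := (le_abs_self _).trans (habs i hi)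
    have h3 : ((d : ℝ) - hA.eigenvalues i) * ((b i : V → ℝ) ⬝ᵥ fun _ => (1 : ℝ)) = 0 := by
      linarith
    rcases mul_eq_zero.1 h3 with h | h
    · linarith
    · exact h
  -- Constants have only a z-component, which is nonzero by Parseval, so mean zero means
  -- orthogonality to `b z`.
  have hφz : (b z : V → ℝ) ⬝ᵥ φ = 0 := by
    have h1 := b.sum_inner_mul_inner (WithLp.toLp 2 fun _ => (1 : ℝ)) (WithLp.toLp 2 φ)
    rw [Finset.sum_eq_single z (by
      intro i _ hi
      rw [real_inner_comm, hinner, horth i hi, zero_mul]) (by simp),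
      real_inner_comm, hinner, hinner, EuclideanSpace.inner_eq_star_dotProduct] at h1
    have h2 : φ ⬝ᵥ star (fun _ : V => (1 : ℝ)) = 0 := by
      simpa [dotProduct] using hφ
    rw [h2] at h1
    rcases mul_eq_zero.1 h1 with h | h
    · exfalso
      have h3 := hparseval fun _ => (1 : ℝ)
      have h4 : ∀ i, (b i : V → ℝ) ⬝ᵥ (fun _ => (1 : ℝ)) = 0 := fun i => by
        by_cases hi : i = z
        · rw [hi, h]
        · exact horth i hi
      simp only [h4] at h3
      simp at h3
      rw [h3] at hV
      simp at hV
    · exact h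
  rw [hparseval (M *ᵥ φ), hparseval φ, Finset.mul_sum]
  refine Finset.sum_le_sum fun i _ => ?_
  rw [hinnerM, mul_pow]
  by_cases hi : i = z
  · rw [hi, hφz]; simp
  · refine mul_le_mul_of_nonneg_right ?_ (sq_nonneg _)
    exact sq_le_sq' (by linarith [(abs_le.1 (habs i hi)).1]) (abs_le.1 (habs i hi)).2

/-! ### Contracting Markov kernels -/

/-- A symmetric Markov kernel on a finite set that contracts functions of mean zero by `ε`. -/
structure Matrix.IsContracting {X : Type*} [Fintype X] (K : Matrix X X ℝ) (ε : ℝ) : Prop where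
  symm : ∀ x y, K x y = K y x
  nonneg : ∀ x y, 0 ≤ K x y
  sum_eq_one : ∀ x, ∑ y, K x y = 1
  contract : ∀ φ : X → ℝ, ∑ x, φ x = 0 → ∑ x, (K *ᵥ φ) x ^ 2 ≤ ε ^ 2 * ∑ x, φ x ^ 2

/-- The mean value of a function on a finite set. -/
noncomputable def finMean {X : Type*} [Fintype X] (φ : X → ℝ) : ℝ :=
  (∑ x, φ x) / Fintype.card X

section Mean

variable {X : Type*} [Fintype X] [Nonempty X]

theorem card_mul_finMean (φ : X → ℝ) : (Fintype.card X : ℝ) * finMean φ = ∑ x, φ x := by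
  rw [finMean, mul_div_cancel₀]
  exact_mod_cast Fintype.card_ne_zero

theorem sum_sub_finMean (φ : X → ℝ) : ∑ x, (φ x - finMean φ) = 0 := by
  rw [Finset.sum_sub_distrib, ← card_mul_finMean φ]
  simp

theorem sum_sq_eq_add (φ : X → ℝ) :
    ∑ x, φ x ^ 2 = ∑ x, (φ x - finMean φ) ^ 2 + Fintype.card X * finMean φ ^ 2 := by
  have h := sum_sub_finMean φ
  have : ∀ x, φ x ^ 2 = (φ x - finMean φ) ^ 2 + 2 * finMean φ * (φ x - finMean φ)
      + finMean φ ^ 2 := fun x => by ring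
  rw [Finset.sum_congr rfl fun x _ => this x, Finset.sum_add_distrib, Finset.sum_add_distrib,
    ← Finset.mul_sum, h]
  simp

theorem sum_sq_sub_finMean_le (φ : X → ℝ) : ∑ x, (φ x - finMean φ) ^ 2 ≤ ∑ x, φ x ^ 2 := by
  rw [sum_sq_eq_add φ]
  have : 0 ≤ (Fintype.card X : ℝ) * finMean φ ^ 2 := by positivity
  linarith

theorem finMean_nonneg {φ : X → ℝ} (h : ∀ x, 0 ≤ φ x) : 0 ≤ finMean φ :=
  div_nonneg (Finset.sum_nonneg fun x _ => h x) (Nat.cast_nonneg _)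

theorem finMean_le_one {φ : X → ℝ} (h : ∀ x, φ x ≤ 1) : finMean φ ≤ 1 := by
  have hc : (0 : ℝ) < Fintype.card X := by exact_mod_cast Fintype.card_pos
  rw [finMean, div_le_one hc]
  calc ∑ x, φ x ≤ ∑ _x : X, (1 : ℝ) := Finset.sum_le_sum fun x _ => h x
    _ = Fintype.card X := by simp

end Mean

namespace Matrix.IsContracting

variable {X : Type*} [Fintype X] {K : Matrix X X ℝ} {ε : ℝ}

theorem col_sum (hK : K.IsContracting ε) (y : X) : ∑ x, K x y = 1 := by
  rw [← hK.sum_eq_one y]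
  exact Finset.sum_congr rfl fun x _ => hK.symm x y

theorem sum_mulVec (hK : K.IsContracting ε) (φ : X → ℝ) : ∑ x, (K *ᵥ φ) x = ∑ x, φ x := by
  simp only [mulVec, dotProduct]
  rw [Finset.sum_comm]
  refine Finset.sum_congr rfl fun y _ => ?_
  rw [← Finset.sum_mul, hK.col_sum, one_mul]

theorem finMean_mulVec (hK : K.IsContracting ε) (φ : X → ℝ) :
    finMean (K *ᵥ φ) = finMean φ := by
  rw [finMean, finMean, hK.sum_mulVec]

theorem mulVec_sub_const (hK : K.IsContracting ε) (φ : X → ℝ) (c : ℝ) (x : X) :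
    (K *ᵥ fun y => φ y - c) x = (K *ᵥ φ) x - c := by
  simp only [mulVec, dotProduct, mul_sub, Finset.sum_sub_distrib]
  rw [← Finset.sum_mul, hK.sum_eq_one, one_mul]

variable [Nonempty X]

theorem contract_variance (hK : K.IsContracting ε) (φ : X → ℝ) :
    ∑ x, ((K *ᵥ φ) x - finMean φ) ^ 2 ≤ ε ^ 2 * ∑ x, (φ x - finMean φ) ^ 2 := by
  have := hK.contract _ (sum_sub_finMean φ)
  simpa only [hK.mulVec_sub_const] using this

theorem sum_sq_mulVec_le (hK : K.IsContracting ε) (hε0 : 0 ≤ ε) (hε : ε ≤ 1) (φ : X → ℝ) :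
    ∑ x, (K *ᵥ φ) x ^ 2 ≤ ∑ x, φ x ^ 2 := by
  rw [sum_sq_eq_add (K *ᵥ φ), sum_sq_eq_add φ, hK.finMean_mulVec]
  have h1 := hK.contract_variance φ
  have h2 : 0 ≤ ∑ x, (φ x - finMean φ) ^ 2 := Finset.sum_nonneg fun _ _ => sq_nonneg _
  have h3 : ε ^ 2 ≤ 1 := pow_le_one₀ hε0 hε
  nlinarith

theorem mono (hK : K.IsContracting ε) (hε0 : 0 ≤ ε) {δ : ℝ} (h : ε ≤ δ) : K.IsContracting δ where
  symm := hK.symm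
  nonneg := hK.nonneg
  sum_eq_one := hK.sum_eq_one
  contract φ hφ := (hK.contract φ hφ).trans (mul_le_mul_of_nonneg_right
    (pow_le_pow_left₀ hε0 h 2) (Finset.sum_nonneg fun _ _ => sq_nonneg _))

theorem sq [DecidableEq X] (hK : K.IsContracting ε) : (K ^ 2).IsContracting (ε ^ 2) where
  symm x y := by
    rw [pow_two, mul_apply, mul_apply]
    refine Finset.sum_congr rfl fun z _ => ?_
    rw [hK.symm x z, hK.symm z y, mul_comm]
  nonneg x y := by
    rw [pow_two, mul_apply]
    exact Finset.sum_nonneg fun z _ => mul_nonneg (hK.nonneg _ _) (hK.nonneg _ _)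
  sum_eq_one x := by
    simp only [pow_two, mul_apply]
    rw [Finset.sum_comm]
    simp only [← Finset.mul_sum, hK.sum_eq_one, mul_one]
  contract φ hφ := by
    have h1 := hK.contract φ hφ
    have h2 := hK.contract (K *ᵥ φ) (by rw [hK.sum_mulVec, hφ])
    rw [mulVec_mulVec, ← pow_two] at h2
    calc _ ≤ _ := h2
      _ ≤ ε ^ 2 * (ε ^ 2 * ∑ x, φ x ^ 2) := mul_le_mul_of_nonneg_left h1 (sq_nonneg ε)
      _ = _ := by ring

/-- The tensor product of two contracting kernels is contracting. -/
theorem kronecker {Y : Type*} [Fintype Y] [Nonempty Y] {L : Matrix Y Y ℝ}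
    (hK : K.IsContracting ε) (hL : L.IsContracting ε) (hε0 : 0 ≤ ε) (hε : ε ≤ 1) :
    (kroneckerMap (fun a b => a * b) K L).IsContracting ε where
  symm x y := by simp only [kroneckerMap_apply]; rw [hK.symm, hL.symm]
  nonneg x y := mul_nonneg (hK.nonneg _ _) (hL.nonneg _ _)
  sum_eq_one x := by
    simp only [kroneckerMap_apply]
    rw [Fintype.sum_prod_type]
    simp only [← Finset.mul_sum, hL.sum_eq_one, mul_one, hK.sum_eq_one]
  contract F hF := by
    -- F splits into its fibre means over X and a remainder of mean zero on each fibre. K contracts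
    -- the first part; L contracts the second, on which K is merely nonexpansive. The two parts stay
    -- orthogonal.
    set Fm : X → ℝ := fun x => finMean fun y => F (x, y) with hFm
    set P : X → Y → ℝ := fun x y => (L *ᵥ fun y' => F (x, y')) y with hP
    have hval : ∀ x y, (kroneckerMap (fun a b => a * b) K L *ᵥ F) (x, y)
        = (K *ᵥ fun x' => P x' y) x := by
      intro x y
      simp only [hP, mulVec, dotProduct, kroneckerMap_apply]
      rw [Fintype.sum_prod_type]
      refine Finset.sum_congr rfl fun x' _ => ?_
      rw [Finset.mul_sum]
      exact Finset.sum_congr rfl fun y' _ => by ring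
    have hmean : ∀ x, finMean (fun y => (K *ᵥ fun x' => P x' y) x) = (K *ᵥ Fm) x := by
      intro x
      simp only [finMean, mulVec, dotProduct, hFm]
      rw [Finset.sum_comm, Finset.sum_div]
      refine Finset.sum_congr rfl fun x' _ => ?_
      rw [← Finset.mul_sum, hP]
      simp only
      rw [hL.sum_mulVec, mul_div_assoc]
    have hFm0 : ∑ x, Fm x = 0 := by
      simp only [hFm, finMean]
      rw [← Finset.sum_div, ← Fintype.sum_prod_type', hF, zero_div]
    have h1 : ∑ x, (K *ᵥ Fm) x ^ 2 ≤ ε ^ 2 * ∑ x, Fm x ^ 2 := hK.contract Fm hFm0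
    have h2 : ∑ x, ∑ y, ((K *ᵥ fun x' => P x' y) x - (K *ᵥ Fm) x) ^ 2
        ≤ ε ^ 2 * ∑ x, ∑ y, (F (x, y) - Fm x) ^ 2 := by
      calc ∑ x, ∑ y, ((K *ᵥ fun x' => P x' y) x - (K *ᵥ Fm) x) ^ 2
          = ∑ y, ∑ x, (K *ᵥ fun x' => P x' y - Fm x') x ^ 2 := by
            rw [Finset.sum_comm]
            refine Finset.sum_congr rfl fun y _ => Finset.sum_congr rfl fun x _ => ?_
            have : (fun x' => P x' y - Fm x') = (fun x' => P x' y) - Fm := rfl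
            rw [this, mulVec_sub]
            rfl
        _ ≤ ∑ y, ∑ x, (P x y - Fm x) ^ 2 :=
            Finset.sum_le_sum fun y _ => hK.sum_sq_mulVec_le hε0 hε _
        _ = ∑ x, ∑ y, (P x y - Fm x) ^ 2 := Finset.sum_comm
        _ ≤ ∑ x, ε ^ 2 * ∑ y, (F (x, y) - Fm x) ^ 2 :=
            Finset.sum_le_sum fun x _ => hL.contract_variance fun y => F (x, y)
        _ = _ := by rw [Finset.mul_sum]
    rw [Fintype.sum_prod_type, Fintype.sum_prod_type]
    simp only [hval]
    rw [Finset.sum_congr rfl fun x _ => sum_sq_eq_add fun y => (K *ᵥ fun x' => P x' y) x,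
      Finset.sum_congr rfl fun x _ => sum_sq_eq_add fun y => F (x, y)]
    simp only [hmean, Finset.sum_add_distrib, ← Finset.mul_sum]
    have hY : (0 : ℝ) ≤ Fintype.card Y := Nat.cast_nonneg _
    have h3 := mul_le_mul_of_nonneg_left h1 hY
    simp only [hFm] at h2 h3 ⊢
    linarith

/-- A lower bound for the correlation of a function with the image of another one. -/
theorem correlation_ge (hK : K.IsContracting ε) (hε0 : 0 < ε) (φ ψ : X → ℝ) :
    Fintype.card X * (finMean φ * finMean ψ)
      - ε * (∑ x, (φ x - finMean φ) ^ 2 + ∑ x, (ψ x - finMean ψ) ^ 2) / 2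
      ≤ ∑ x, φ x * (K *ᵥ ψ) x := by
  have h1 := hK.contract_variance ψ
  have h2 : ∑ x, φ x * (K *ᵥ ψ) x = Fintype.card X * (finMean φ * finMean ψ)
      + ∑ x, (φ x - finMean φ) * ((K *ᵥ ψ) x - finMean ψ) := by
    have e1 := card_mul_finMean φ
    have e2 := card_mul_finMean (K *ᵥ ψ)
    rw [hK.finMean_mulVec] at e2
    have : ∀ x, (φ x - finMean φ) * ((K *ᵥ ψ) x - finMean ψ) = φ x * (K *ᵥ ψ) x
        - φ x * finMean ψ - finMean φ * (K *ᵥ ψ) x + finMean φ * finMean ψ := fun x => by ring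
    rw [Finset.sum_congr rfl fun x _ => this x, Finset.sum_add_distrib, Finset.sum_sub_distrib,
      Finset.sum_sub_distrib, ← Finset.sum_mul, ← Finset.mul_sum, ← e1, ← e2]
    simp
    ring
  -- Weighted arithmetic-geometric mean inequality: the weights ε and 1/ε turn the contraction by ε²
  -- into a loss of ε/2 for each of the two variances.
  have h3 : -(ε / 2 * ∑ x, (φ x - finMean φ) ^ 2
      + ε⁻¹ / 2 * ∑ x, ((K *ᵥ ψ) x - finMean ψ) ^ 2)
      ≤ ∑ x, (φ x - finMean φ) * ((K *ᵥ ψ) x - finMean ψ) := by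
    rw [Finset.mul_sum, Finset.mul_sum, ← Finset.sum_add_distrib, ← Finset.sum_neg_distrib]
    refine Finset.sum_le_sum fun x _ => ?_
    generalize φ x - finMean φ = s
    generalize (K *ᵥ ψ) x - finMean ψ = t
    have : 0 ≤ (ε * s + t) ^ 2 / (2 * ε) := by positivity
    have e : (ε * s + t) ^ 2 / (2 * ε) = ε / 2 * s ^ 2 + ε⁻¹ / 2 * t ^ 2 + s * t := by
      field_simp
      ring
    linarith
  have h4 : ε⁻¹ / 2 * ∑ x, ((K *ᵥ ψ) x - finMean ψ) ^ 2
      ≤ ε / 2 * ∑ x, (ψ x - finMean ψ) ^ 2 := by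
    calc _ ≤ ε⁻¹ / 2 * (ε ^ 2 * ∑ x, (ψ x - finMean ψ) ^ 2) :=
          mul_le_mul_of_nonneg_left h1 (by positivity)
      _ = _ := by field_simp
  linarith

end Matrix.IsContracting

/-! ### Functions on triples: marginals and tensor products of powers -/

section Product

variable {V : Type*} [Fintype V]

theorem sum_pi_fin_three {R : Type*} [AddCommMonoid R] (Φ : (Fin 3 → V) → R) :
    ∑ x, Φ x = ∑ u, ∑ v, ∑ w, Φ ![u, v, w] := by
  rw [← Equiv.sum_comp (⟨fun p => ![p.1, p.2.1, p.2.2], fun x => (x 0, x 1, x 2), fun p => rfl,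
    fun x => by ext i; fin_cases i <;> rfl⟩ : (V × V × V) ≃ (Fin 3 → V)) Φ,
    Fintype.sum_prod_type]
  refine Finset.sum_congr rfl fun u _ => ?_
  rw [Fintype.sum_prod_type]
  rfl

variable [DecidableEq V]

/-- The average of `F` over the triples with a given `i`-th coordinate. -/
noncomputable def marginal (F : (Fin 3 → V) → ℝ) (i : Fin 3) (v : V) : ℝ :=
  (∑ x : Fin 3 → V, if x i = v then F x else 0) / (Fintype.card V : ℝ) ^ 2

/-- The variance of the `i`-th marginal. -/
noncomputable def marginalVariance (F : (Fin 3 → V) → ℝ) (i : Fin 3) : ℝ :=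
  (∑ v, (marginal F i v - finMean F) ^ 2) / Fintype.card V

/-- The kernel with powers `l 0`, `l 1`, `l 2` of `K` on the three coordinates. -/
noncomputable def tensorApply (K : Matrix V V ℝ) (l : Fin 3 → ℕ) (F : (Fin 3 → V) → ℝ)
    (m : Fin 3 → V) : ℝ :=
  ∑ x : Fin 3 → V, (∏ i, (K ^ l i) (m i) (x i)) * F x

theorem card_pi_fin_three : (Fintype.card (Fin 3 → V) : ℝ) = (Fintype.card V : ℝ) ^ 3 := by
  simp

variable [Nonempty V]

theorem sum_mul_apply_coord (F : (Fin 3 → V) → ℝ) (i : Fin 3) (ψ : V → ℝ) :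
    ∑ x, F x * ψ (x i) = (Fintype.card V : ℝ) ^ 2 * ∑ v, marginal F i v * ψ v := by
  have hc : (Fintype.card V : ℝ) ≠ 0 := by exact_mod_cast Fintype.card_ne_zero
  have : ∀ v, marginal F i v * ψ v
      = (∑ x : Fin 3 → V, if x i = v then F x * ψ v else 0) / (Fintype.card V : ℝ) ^ 2 := by
    intro v
    rw [marginal, div_mul_eq_mul_div, Finset.sum_mul]
    simp only [ite_mul, zero_mul]
  simp only [this]
  rw [← Finset.sum_div, mul_div_cancel₀ _ (pow_ne_zero 2 hc), Finset.sum_comm]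
  simp

theorem sum_marginal (F : (Fin 3 → V) → ℝ) (i : Fin 3) :
    ∑ v, marginal F i v = Fintype.card V * finMean F := by
  have hc : (Fintype.card V : ℝ) ≠ 0 := by exact_mod_cast Fintype.card_ne_zero
  have h1 := sum_mul_apply_coord F i fun _ => 1
  simp only [mul_one] at h1
  rw [← card_mul_finMean F, card_pi_fin_three] at h1
  have h2 : (Fintype.card V : ℝ) ^ 2 * (∑ v, marginal F i v - Fintype.card V * finMean F) = 0 := by
    linear_combination -h1
  rcases mul_eq_zero.1 h2 with h | h
  · exact absurd h (pow_ne_zero 2 hc)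
  · linarith

theorem finMean_marginal (F : (Fin 3 → V) → ℝ) (i : Fin 3) :
    finMean (marginal F i) = finMean F := by
  have hc : (Fintype.card V : ℝ) ≠ 0 := by exact_mod_cast Fintype.card_ne_zero
  rw [finMean, sum_marginal, mul_div_cancel_left₀ _ hc]

theorem sum_sq_marginal_sub (F : (Fin 3 → V) → ℝ) (i : Fin 3) :
    ∑ v, (marginal F i v - finMean F) ^ 2 = Fintype.card V * marginalVariance F i := by
  have hc : (Fintype.card V : ℝ) ≠ 0 := by exact_mod_cast Fintype.card_ne_zero
  rw [marginalVariance, mul_div_cancel₀ _ hc]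

theorem marginal_two (F : (Fin 3 → V) → ℝ) (w : V) :
    marginal F 2 w = finMean fun p : V × V => F ![p.1, p.2, w] := by
  have h : (∑ u, ∑ v, ∑ w', if (![u, v, w'] : Fin 3 → V) 2 = w then F ![u, v, w'] else 0)
      = ∑ u, ∑ v, F ![u, v, w] :=
    Finset.sum_congr rfl fun u _ => Finset.sum_congr rfl fun v _ =>
      (Finset.sum_ite_eq' Finset.univ w fun w' => F ![u, v, w']).trans (if_pos (Finset.mem_univ _))
  rw [marginal, finMean, sum_pi_fin_three, h, Fintype.sum_prod_type]
  simp [pow_two]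

theorem marginal_one (F : (Fin 3 → V) → ℝ) (v : V) :
    marginal F 1 v = finMean fun p : V × V => F ![p.1, v, p.2] := by
  have h : (∑ u, ∑ w, ∑ v', if (![u, v', w] : Fin 3 → V) 1 = v then F ![u, v', w] else 0)
      = ∑ u, ∑ w, F ![u, v, w] :=
    Finset.sum_congr rfl fun u _ => Finset.sum_congr rfl fun w _ =>
      (Finset.sum_ite_eq' Finset.univ v fun v' => F ![u, v', w]).trans (if_pos (Finset.mem_univ _))
  rw [marginal, finMean, sum_pi_fin_three, Finset.sum_congr rfl fun u _ => Finset.sum_comm, h,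
    Fintype.sum_prod_type]
  simp [pow_two]

theorem marginal_nonneg {F : (Fin 3 → V) → ℝ} (h : ∀ x, 0 ≤ F x) (i : Fin 3) (v : V) :
    0 ≤ marginal F i v :=
  div_nonneg (Finset.sum_nonneg fun x _ => by split_ifs <;> simp [h x]) (sq_nonneg _)

/-- The variances of the three marginals add up to at most the second moment. -/
theorem sum_marginalVariance_le (F : (Fin 3 → V) → ℝ) :
    marginalVariance F 0 + marginalVariance F 1 + marginalVariance F 2
      ≤ finMean fun x => F x ^ 2 := by
  have hc : (0 : ℝ) < Fintype.card V := by exact_mod_cast Fintype.card_pos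
  set n : ℝ := (Fintype.card V : ℝ) with hn
  set a := finMean F with ha
  -- The constants and the three centered marginals, as functions of x, are mutually orthogonal. The
  -- claim is Bessel's inequality for the projection of F onto them.
  set θ : Fin 3 → V → ℝ := fun i v => marginal F i v - a with hθ
  have hθ0 : ∀ i, ∑ v, θ i v = 0 := by
    intro i
    simp only [hθ, Finset.sum_sub_distrib, sum_marginal]
    simp [ha]
  have hθF : ∀ i, ∑ x, F x * θ i (x i) = n ^ 2 * ∑ v, θ i v ^ 2 := by
    intro i
    rw [sum_mul_apply_coord]
    congr 1
    have : ∀ v, marginal F i v * θ i v = θ i v ^ 2 + a * θ i v := fun v => by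
      simp only [hθ]; ring
    rw [Finset.sum_congr rfl fun v _ => this v, Finset.sum_add_distrib, ← Finset.mul_sum, hθ0]
    simp
  have hΘ1 : ∑ x : Fin 3 → V, (θ 0 (x 0) + θ 1 (x 1) + θ 2 (x 2)) = 0 := by
    rw [sum_pi_fin_three]
    simp [Finset.sum_add_distrib, hθ0, ← Finset.mul_sum]
  have hΘ2 : ∑ x : Fin 3 → V, (θ 0 (x 0) + θ 1 (x 1) + θ 2 (x 2)) ^ 2
      = n ^ 2 * (∑ v, θ 0 v ^ 2 + ∑ v, θ 1 v ^ 2 + ∑ v, θ 2 v ^ 2) := by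
    have : ∀ x : Fin 3 → V, (θ 0 (x 0) + θ 1 (x 1) + θ 2 (x 2)) ^ 2
        = θ 0 (x 0) ^ 2 + θ 1 (x 1) ^ 2 + θ 2 (x 2) ^ 2 + (2 * θ 0 (x 0) * θ 1 (x 1)
          + 2 * θ 0 (x 0) * θ 2 (x 2) + 2 * θ 1 (x 1) * θ 2 (x 2)) := fun x => by ring
    rw [Finset.sum_congr rfl fun x _ => this x, sum_pi_fin_three]
    simp [Finset.sum_add_distrib, hθ0, ← Finset.mul_sum]
    ring
  have hpos : 0 ≤ ∑ x : Fin 3 → V, (F x - a - (θ 0 (x 0) + θ 1 (x 1) + θ 2 (x 2))) ^ 2 :=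
    Finset.sum_nonneg fun _ _ => sq_nonneg _
  have hexp : ∀ x : Fin 3 → V, (F x - a - (θ 0 (x 0) + θ 1 (x 1) + θ 2 (x 2))) ^ 2
      = (F x - a) ^ 2 + (θ 0 (x 0) + θ 1 (x 1) + θ 2 (x 2)) ^ 2
        + 2 * a * (θ 0 (x 0) + θ 1 (x 1) + θ 2 (x 2))
        - 2 * (F x * θ 0 (x 0)) - 2 * (F x * θ 1 (x 1)) - 2 * (F x * θ 2 (x 2)) := fun x => by
    ring
  rw [Finset.sum_congr rfl fun x _ => hexp x] at hpos
  simp only [Finset.sum_add_distrib, Finset.sum_sub_distrib, ← Finset.mul_sum] at hpos hΘ1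
  rw [hθF, hθF, hθF, hΘ1, hΘ2] at hpos
  have hF := sum_sq_sub_finMean_le F
  have hvar : ∀ i, ∑ v, θ i v ^ 2 = n * marginalVariance F i := fun i => sum_sq_marginal_sub F i
  simp only [hvar] at hpos
  have hfm := card_mul_finMean fun x => F x ^ 2
  rw [card_pi_fin_three] at hfm
  have h3 : n ^ 3 * (marginalVariance F 0 + marginalVariance F 1 + marginalVariance F 2)
      ≤ n ^ 3 * finMean fun x => F x ^ 2 := by
    rw [hfm]
    linarith
  exact le_of_mul_le_mul_left h3 (by positivity)

/-- Pairing `tensorApply` with a product function. -/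
theorem sum_prod_mul_tensorApply (K : Matrix V V ℝ) (hK : ∀ x y, K x y = K y x) (l : Fin 3 → ℕ)
    (F : (Fin 3 → V) → ℝ) (φ : Fin 3 → V → ℝ) :
    ∑ m, (∏ i, φ i (m i)) * tensorApply K l F m
      = ∑ x, F x * ∏ i, ((K ^ l i) *ᵥ φ i) (x i) := by
  have hs : ∀ j, (K ^ j)ᵀ = K ^ j := fun j => by
    rw [transpose_pow]
    congr 1
    ext x y
    exact hK y x
  simp only [tensorApply, Finset.mul_sum]
  rw [Finset.sum_comm]
  refine Finset.sum_congr rfl fun x _ => ?_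
  simp only [mulVec, dotProduct]
  rw [Fintype.prod_sum, Finset.mul_sum]
  refine Finset.sum_congr rfl fun m _ => ?_
  rw [Finset.prod_mul_distrib]
  have : ∏ i, (K ^ l i) (x i) (m i) = ∏ i, (K ^ l i) (m i) (x i) :=
    Finset.prod_congr rfl fun i _ => by
      conv_lhs => rw [← hs (l i)]
      rfl
  rw [this]
  ring

end Product

/-! ### Tensor operators are close to marginals -/

section Contraction

variable {V : Type*} [Fintype V] [DecidableEq V] [Nonempty V] {K : Matrix V V ℝ} {ε : ℝ}

theorem Matrix.IsContracting.sq_of_le_one (hK : K.IsContracting ε) (hε0 : 0 ≤ ε) (hε : ε ≤ 1) :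
    (K ^ 2).IsContracting ε :=
  hK.sq.mono (sq_nonneg ε) (by nlinarith)

theorem Matrix.IsContracting.variance_le (hK : K.IsContracting ε) (φ : V → ℝ) :
    ∑ x, ((K *ᵥ φ) x - finMean φ) ^ 2 ≤ ε ^ 2 * ∑ x, φ x ^ 2 :=
  (hK.contract_variance φ).trans
    (mul_le_mul_of_nonneg_left (sum_sq_sub_finMean_le φ) (sq_nonneg ε))

/-- The leg 0 freezes the last coordinate. On each fibre the operator is the contracting kernel K ⊗
K², which pushes F towards its fibre mean, the marginal. -/
theorem sum_sq_tensorApply_sub_one_two_zero (hK : K.IsContracting ε) (hε0 : 0 ≤ ε) (hε : ε ≤ 1)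
    (F : (Fin 3 → V) → ℝ) :
    ∑ m, (tensorApply K ![1, 2, 0] F m - marginal F 2 (m 2)) ^ 2 ≤ ε ^ 2 * ∑ x, F x ^ 2 := by
  have hk := hK.kronecker (hK.sq_of_le_one hε0 hε) hε0 hε
  have hval : ∀ u v w, tensorApply K ![1, 2, 0] F ![u, v, w]
      = (kroneckerMap (fun a b => a * b) K (K ^ 2) *ᵥ fun p => F ![p.1, p.2, w]) (u, v) := by
    intro u v w
    simp only [tensorApply, mulVec, dotProduct, kroneckerMap_apply]
    rw [sum_pi_fin_three, Fintype.sum_prod_type]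
    simp [Fin.prod_univ_three, one_apply]
  have hsum : ∀ Φ : (Fin 3 → V) → ℝ, ∑ x, Φ x = ∑ w, ∑ p : V × V, Φ ![p.1, p.2, w] := by
    intro Φ
    rw [sum_pi_fin_three, Finset.sum_comm, Finset.sum_congr rfl fun v _ => Finset.sum_comm,
      Finset.sum_comm]
    refine Finset.sum_congr rfl fun w _ => ?_
    rw [Fintype.sum_prod_type, Finset.sum_comm]
  rw [hsum, hsum, Finset.mul_sum]
  refine Finset.sum_le_sum fun w _ => ?_
  have := hk.variance_le fun p => F ![p.1, p.2, w]
  simpa [hval, marginal_two] using this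

theorem sum_sq_tensorApply_sub_two_zero_one (hK : K.IsContracting ε) (hε0 : 0 ≤ ε) (hε : ε ≤ 1)
    (F : (Fin 3 → V) → ℝ) :
    ∑ m, (tensorApply K ![2, 0, 1] F m - marginal F 1 (m 1)) ^ 2 ≤ ε ^ 2 * ∑ x, F x ^ 2 := by
  have hk := (hK.sq_of_le_one hε0 hε).kronecker hK hε0 hε
  have hval : ∀ u v w, tensorApply K ![2, 0, 1] F ![u, v, w]
      = (kroneckerMap (fun a b => a * b) (K ^ 2) K *ᵥ fun p => F ![p.1, v, p.2]) (u, w) := by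
    intro u v w
    simp only [tensorApply, mulVec, dotProduct, kroneckerMap_apply]
    rw [sum_pi_fin_three, Fintype.sum_prod_type]
    simp [Fin.prod_univ_three, one_apply]
  have hsum : ∀ Φ : (Fin 3 → V) → ℝ, ∑ x, Φ x = ∑ v, ∑ p : V × V, Φ ![p.1, v, p.2] := by
    intro Φ
    rw [sum_pi_fin_three, Finset.sum_comm]
    refine Finset.sum_congr rfl fun w _ => ?_
    rw [Fintype.sum_prod_type]
  rw [hsum, hsum, Finset.mul_sum]
  refine Finset.sum_le_sum fun v _ => ?_
  have := hk.variance_le fun p => F ![p.1, v, p.2]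
  simpa [hval, marginal_one] using this

theorem sum_sq_tensorApply_sub_one_one_one (hK : K.IsContracting ε) (hε0 : 0 ≤ ε) (hε : ε ≤ 1)
    (F : (Fin 3 → V) → ℝ) :
    ∑ m, (tensorApply K ![1, 1, 1] F m - finMean F) ^ 2 ≤ ε ^ 2 * ∑ x, F x ^ 2 := by
  have hk := hK.kronecker (hK.kronecker hK hε0 hε) hε0 hε
  have hval : ∀ u v w, tensorApply K ![1, 1, 1] F ![u, v, w]
      = (kroneckerMap (fun a b => a * b) K (kroneckerMap (fun a b => a * b) K K) *ᵥ
        fun p => F ![p.1, p.2.1, p.2.2]) (u, v, w) := by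
    intro u v w
    simp only [tensorApply, mulVec, dotProduct, kroneckerMap_apply]
    rw [sum_pi_fin_three]
    simp only [Fintype.sum_prod_type]
    simp [Fin.prod_univ_three, mul_assoc]
  have hsum : ∀ Φ : (Fin 3 → V) → ℝ, ∑ x, Φ x = ∑ p : V × V × V, Φ ![p.1, p.2.1, p.2.2] := by
    intro Φ
    rw [sum_pi_fin_three]
    simp only [Fintype.sum_prod_type]
  have hm : finMean F = finMean fun p : V × V × V => F ![p.1, p.2.1, p.2.2] := by
    rw [finMean, finMean, hsum]
    simp [pow_succ, mul_assoc]
  rw [hsum, hsum, hm]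
  have := hk.variance_le fun p => F ![p.1, p.2.1, p.2.2]
  simpa [hval] using this

end Contraction

/-- Exactly, fgh minus the linear part equals (f−f₀)(g−b)h + b(f−f₀)(h−h₀) + f₀(g−b)(h−h₀). Only
products of two errors are lost, so errors of order ε in mean square cost ε²; the linear part is
evaluated separately. -/
theorem mul_mul_ge_of_approx {f g h f₀ b h₀ : ℝ} (hh0 : 0 ≤ h) (hh1 : h ≤ 1) (hf0 : 0 ≤ f₀)
    (hf1 : f₀ ≤ 1) (hb : 0 ≤ b) :
    b * (f * h₀) + f₀ * h₀ * g + b * (f₀ * h) - 2 * b * (f₀ * h₀)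
      - (((f - f₀) ^ 2 + (g - b) ^ 2) + b * ((f - f₀) ^ 2 + (h - h₀) ^ 2)
        + ((g - b) ^ 2 + (h - h₀) ^ 2)) / 2 ≤ f * g * h := by
  have aux : ∀ s t r : ℝ, 0 ≤ r → r ≤ 1 → -((s ^ 2 + t ^ 2) / 2) ≤ s * t * r := by
    intro s t r h0 h1
    nlinarith [sq_nonneg (s + t), sq_nonneg s, sq_nonneg t,
      mul_nonneg h0 (sq_nonneg (s + t)), mul_nonneg (sub_nonneg.2 h1) (sq_nonneg s),
      mul_nonneg (sub_nonneg.2 h1) (sq_nonneg t)]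
  have h1 := aux (f - f₀) (g - b) h hh0 hh1
  have h2 := mul_le_mul_of_nonneg_left (aux (f - f₀) (h - h₀) 1 zero_le_one le_rfl) hb
  have h3 := aux (g - b) (h - h₀) f₀ hf0 hf1
  nlinarith

/-! ### Counting weighted tripods -/

section Tripod

variable {V : Type*} [Fintype V] [DecidableEq V] [Nonempty V] {K : Matrix V V ℝ} {ε : ℝ}

theorem sum_apply_coord (i : Fin 3) (ψ : V → ℝ) :
    ∑ x : Fin 3 → V, ψ (x i) = (Fintype.card V : ℝ) ^ 2 * ∑ v, ψ v := by
  rw [sum_pi_fin_three]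
  fin_cases i <;> simp [← Finset.mul_sum] <;> ring

theorem marginal_le_one {F : (Fin 3 → V) → ℝ} (h : ∀ x, F x ≤ 1) (v : V) :
    marginal F 2 v ≤ 1 := by
  rw [marginal_two]
  exact finMean_le_one fun p => h _

theorem Matrix.IsContracting.pow_nonneg (hK : K.IsContracting ε) (j : ℕ) (x y : V) :
    0 ≤ (K ^ j) x y := by
  induction j generalizing x y with
  | zero => rw [pow_zero, one_apply]; split_ifs <;> norm_num
  | succ j ih =>
    rw [pow_succ, mul_apply]
    exact Finset.sum_nonneg fun z _ => mul_nonneg (ih x z) (hK.nonneg z y)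

theorem Matrix.IsContracting.sum_pow (hK : K.IsContracting ε) (j : ℕ) (x : V) :
    ∑ y, (K ^ j) x y = 1 := by
  induction j generalizing x with
  | zero => simp [one_apply]
  | succ j ih =>
    simp only [pow_succ, mul_apply]
    rw [Finset.sum_comm]
    simp only [← Finset.mul_sum, hK.sum_eq_one, mul_one, ih]

theorem tensorApply_nonneg (hK : K.IsContracting ε) (l : Fin 3 → ℕ) {F : (Fin 3 → V) → ℝ}
    (h : ∀ x, 0 ≤ F x) (m : Fin 3 → V) : 0 ≤ tensorApply K l F m :=
  Finset.sum_nonneg fun x _ => mul_nonneg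
    (Finset.prod_nonneg fun i _ => hK.pow_nonneg (l i) (m i) (x i)) (h x)

theorem tensorApply_le_one (hK : K.IsContracting ε) (l : Fin 3 → ℕ) {F : (Fin 3 → V) → ℝ}
    (h : ∀ x, F x ≤ 1) (m : Fin 3 → V) : tensorApply K l F m ≤ 1 := by
  calc tensorApply K l F m ≤ ∑ x : Fin 3 → V, ∏ i, (K ^ l i) (m i) (x i) :=
        Finset.sum_le_sum fun x _ => mul_le_of_le_one_right
          (Finset.prod_nonneg fun i _ => hK.pow_nonneg (l i) (m i) (x i)) (h x)
    _ = ∏ i, ∑ v, (K ^ l i) (m i) v := (Fintype.prod_sum _).symm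
    _ = 1 := Finset.prod_eq_one fun i _ => hK.sum_pow (l i) (m i)

/-- Lower bound for the number of tripods with leg lengths `(1, 2, 0)`, `(1, 1, 1)`, `(2, 0, 1)`
and end points weighted by `F`, `G`, `H`. -/
theorem sum_tensorApply_mul_ge (hK : K.IsContracting ε) (hε0 : 0 < ε) (hε : ε ≤ 1)
    {F G H : (Fin 3 → V) → ℝ} (hF0 : ∀ x, 0 ≤ F x) (hF1 : ∀ x, F x ≤ 1)
    (hG0 : ∀ x, 0 ≤ G x) (hG1 : ∀ x, G x ≤ 1) (hH0 : ∀ x, 0 ≤ H x) (hH1 : ∀ x, H x ≤ 1)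
    {a b c : ℝ} (ha : finMean F = a) (hb : finMean G = b) (hc : finMean H = c) :
    (Fintype.card V : ℝ) ^ 3 * (a * b * c
      - b * (ε ^ 2 * (marginalVariance F 1 + marginalVariance H 1)) / 2
      - ε * (a * (marginalVariance G 1 + marginalVariance H 1)
        + c * (marginalVariance G 2 + marginalVariance F 2)
        + b * (marginalVariance F 2 + marginalVariance H 2)) / 2
      - ε ^ 2 * (marginalVariance F 2 + marginalVariance H 1) / 2
      - ε ^ 2 * (a + 2 * b + c + a * b + b * c) / 2)
    ≤ ∑ m, tensorApply K ![1, 2, 0] F m * tensorApply K ![1, 1, 1] G m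
        * tensorApply K ![2, 0, 1] H m := by
  have hn0 : (0 : ℝ) < Fintype.card V := by exact_mod_cast Fintype.card_pos
  set n : ℝ := (Fintype.card V : ℝ) with hn
  have hsymm := hK.symm
  have ha0 : 0 ≤ a := ha ▸ finMean_nonneg hF0
  have hb0 : 0 ≤ b := hb ▸ finMean_nonneg hG0
  have hc0 : 0 ≤ c := hc ▸ finMean_nonneg hH0
  set f := tensorApply K ![1, 2, 0] F with hf
  set g := tensorApply K ![1, 1, 1] G with hg
  set h := tensorApply K ![2, 0, 1] H with hh
  set A := marginal F 2 with hA
  set C := marginal H 1 with hC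
  have hmA : finMean A = a := by rw [hA, finMean_marginal, ha]
  have hmC : finMean C = c := by rw [hC, finMean_marginal, hc]
  have sqle : ∀ {Φ : (Fin 3 → V) → ℝ} {t : ℝ}, (∀ x, 0 ≤ Φ x) → (∀ x, Φ x ≤ 1) → finMean Φ = t →
      ∑ x, Φ x ^ 2 ≤ n ^ 3 * t := by
    intro Φ t h0 h1 ht
    rw [← ht, hn, ← card_pi_fin_three, card_mul_finMean]
    exact Finset.sum_le_sum fun x _ => by nlinarith [h0 x, h1 x]
  have r1 : ∑ m, (f m - A (m 2)) ^ 2 ≤ ε ^ 2 * (n ^ 3 * a) :=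
    (sum_sq_tensorApply_sub_one_two_zero hK hε0.le hε F).trans
      (mul_le_mul_of_nonneg_left (sqle hF0 hF1 ha) (sq_nonneg ε))
  have r2 : ∑ m, (g m - b) ^ 2 ≤ ε ^ 2 * (n ^ 3 * b) := by
    rw [← hb]
    exact (sum_sq_tensorApply_sub_one_one_one hK hε0.le hε G).trans
      (mul_le_mul_of_nonneg_left (sqle hG0 hG1 rfl) (sq_nonneg ε))
  have r3 : ∑ m, (h m - C (m 1)) ^ 2 ≤ ε ^ 2 * (n ^ 3 * c) :=
    (sum_sq_tensorApply_sub_two_zero_one hK hε0.le hε H).trans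
      (mul_le_mul_of_nonneg_left (sqle hH0 hH1 hc) (sq_nonneg ε))
  have hvar : ∀ (Φ : (Fin 3 → V) → ℝ) i,
      ∑ v, (marginal Φ i v - finMean (marginal Φ i)) ^ 2 = n * marginalVariance Φ i := by
    intro Φ i
    rw [finMean_marginal, sum_sq_marginal_sub]
  -- the three mixed terms
  have s1 : n ^ 3 * (a * c - ε ^ 2 * (marginalVariance F 1 + marginalVariance H 1) / 2)
      ≤ ∑ m, f m * C (m 1) := by
    have e := sum_prod_mul_tensorApply K hsymm ![1, 2, 0] F ![fun _ => 1, C, fun _ => 1]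
    have h1 : ∀ x : V, (K *ᵥ fun _ => (1 : ℝ)) x = 1 := fun x => by
      simp [mulVec, dotProduct, hK.sum_eq_one]
    simp only [Fin.prod_univ_three, cons_val_zero, cons_val_one, cons_val,
      pow_zero, pow_one, one_mulVec, one_mul, mul_one, h1] at e
    have e2 : ∑ m, f m * C (m 1) = n ^ 2 * ∑ v, marginal F 1 v * ((K ^ 2) *ᵥ C) v := by
      rw [← sum_mul_apply_coord, ← e]
      exact Finset.sum_congr rfl fun m _ => mul_comm _ _
    have e3 := hK.sq.correlation_ge (pow_pos hε0 2) (marginal F 1) C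
    rw [hvar, hvar, finMean_marginal, hmC, ha] at e3
    rw [e2]
    calc _ = n ^ 2 * (n * (a * c)
          - ε ^ 2 * (n * marginalVariance F 1 + n * marginalVariance H 1) / 2) := by ring
      _ ≤ _ := mul_le_mul_of_nonneg_left e3 (by positivity)
  have s2 : n ^ 3 * (a * c - ε * (marginalVariance F 2 + marginalVariance H 2) / 2)
      ≤ ∑ m, A (m 2) * h m := by
    have e := sum_prod_mul_tensorApply K hsymm ![2, 0, 1] H ![fun _ => 1, fun _ => 1, A]
    have h1 : ∀ x : V, ((K ^ 2) *ᵥ fun _ => (1 : ℝ)) x = 1 := fun x => by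
      simp [mulVec, dotProduct, hK.sq.sum_eq_one]
    simp only [Fin.prod_univ_three, cons_val_zero, cons_val_one, cons_val,
      pow_zero, pow_one, one_mulVec, one_mul, mul_one, h1] at e
    have e2 : ∑ m, A (m 2) * h m = n ^ 2 * ∑ v, marginal H 2 v * (K *ᵥ A) v := by
      rw [← sum_mul_apply_coord, ← e]
    have e3 := hK.correlation_ge hε0 (marginal H 2) A
    rw [hvar, hvar, finMean_marginal, hmA, hc] at e3
    rw [e2]
    calc _ = n ^ 2 * (n * (c * a)
          - ε * (n * marginalVariance H 2 + n * marginalVariance F 2) / 2) := by ring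
      _ ≤ _ := mul_le_mul_of_nonneg_left e3 (by positivity)
  -- With KC = c + w and KA = a + u, the terms linear in w or u are correlations with marginals of
  -- G, and the product w·u is of second order.
  have s3 : n ^ 3 * (a * b * c - ε * (a * (marginalVariance G 1 + marginalVariance H 1)
        + c * (marginalVariance G 2 + marginalVariance F 2)) / 2
        - ε ^ 2 * (marginalVariance F 2 + marginalVariance H 1) / 2)
      ≤ ∑ m, A (m 2) * C (m 1) * g m := by
    have e := sum_prod_mul_tensorApply K hsymm ![1, 1, 1] G ![fun _ => 1, C, A]
    have h1 : ∀ x : V, (K *ᵥ fun _ => (1 : ℝ)) x = 1 := fun x => by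
      simp [mulVec, dotProduct, hK.sum_eq_one]
    simp only [Fin.prod_univ_three, cons_val_zero, cons_val_one, cons_val,
      pow_one, one_mul, h1] at e
    have e2 : ∑ m, A (m 2) * C (m 1) * g m
        = ∑ x, G x * ((K *ᵥ C) (x 1) * (K *ᵥ A) (x 2)) := by
      rw [← e]
      exact Finset.sum_congr rfl fun m _ => by ring
    set w : V → ℝ := fun v => (K *ᵥ C) v - c with hw
    set u : V → ℝ := fun v => (K *ᵥ A) v - a with hu
    have hw2 : ∑ v, w v ^ 2 ≤ ε ^ 2 * (n * marginalVariance H 1) := by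
      have := hK.contract_variance C
      rwa [hvar, hmC] at this
    have hu2 : ∑ v, u v ^ 2 ≤ ε ^ 2 * (n * marginalVariance F 2) := by
      have := hK.contract_variance A
      rwa [hvar, hmA] at this
    have t1 : n ^ 2 * (-(ε * (n * marginalVariance G 1 + n * marginalVariance H 1) / 2))
        ≤ ∑ x, G x * w (x 1) := by
      rw [sum_mul_apply_coord]
      refine mul_le_mul_of_nonneg_left ?_ (by positivity)
      have e3 := hK.correlation_ge hε0 (marginal G 1) C
      rw [hvar, hvar, finMean_marginal, hmC, hb] at e3
      have : ∑ v, marginal G 1 v * w v = ∑ v, marginal G 1 v * (K *ᵥ C) v - n * (b * c) := by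
        simp only [hw, mul_sub, Finset.sum_sub_distrib]
        rw [← Finset.sum_mul, sum_marginal, hb]
        ring
      linarith
    have t2 : n ^ 2 * (-(ε * (n * marginalVariance G 2 + n * marginalVariance F 2) / 2))
        ≤ ∑ x, G x * u (x 2) := by
      rw [sum_mul_apply_coord]
      refine mul_le_mul_of_nonneg_left ?_ (by positivity)
      have e3 := hK.correlation_ge hε0 (marginal G 2) A
      rw [hvar, hvar, finMean_marginal, hmA, hb] at e3
      have : ∑ v, marginal G 2 v * u v = ∑ v, marginal G 2 v * (K *ᵥ A) v - n * (b * a) := by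
        simp only [hu, mul_sub, Finset.sum_sub_distrib]
        rw [← Finset.sum_mul, sum_marginal, hb]
        ring
      linarith
    have t3 : -(n ^ 2 * (∑ v, w v ^ 2 + ∑ v, u v ^ 2) / 2)
        ≤ ∑ x, G x * (w (x 1) * u (x 2)) := by
      have h1 := sum_apply_coord 1 fun v => w v ^ 2
      have h2 := sum_apply_coord 2 fun v => u v ^ 2
      calc _ = ∑ x : Fin 3 → V, -((w (x 1) ^ 2 + u (x 2) ^ 2) / 2) := by
            rw [Finset.sum_neg_distrib, ← Finset.sum_div, Finset.sum_add_distrib, h1, h2]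
            ring
        _ ≤ _ := Finset.sum_le_sum fun x _ => by
            have g0 := hG0 x
            have g1 := hG1 x
            generalize w (x 1) = s
            generalize u (x 2) = t
            nlinarith [mul_nonneg g0 (sq_nonneg (s + t)),
              mul_nonneg (sub_nonneg.2 g1) (sq_nonneg s),
              mul_nonneg (sub_nonneg.2 g1) (sq_nonneg t)]
    have hsplit : ∑ x, G x * ((K *ᵥ C) (x 1) * (K *ᵥ A) (x 2))
        = ∑ x, G x * (w (x 1) * u (x 2)) + a * ∑ x, G x * w (x 1) + c * ∑ x, G x * u (x 2)
          + a * c * ∑ x, G x := by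
      rw [Finset.mul_sum, Finset.mul_sum, Finset.mul_sum, ← Finset.sum_add_distrib,
        ← Finset.sum_add_distrib, ← Finset.sum_add_distrib]
      exact Finset.sum_congr rfl fun x _ => by simp only [hw, hu]; ring
    have hGs : ∑ x, G x = n ^ 3 * b := by
      rw [← card_mul_finMean G, card_pi_fin_three, hb]
    rw [e2, hsplit, hGs]
    have m1 := mul_le_mul_of_nonneg_left t1 ha0
    have m2 := mul_le_mul_of_nonneg_left t2 hc0
    have m3 := mul_le_mul_of_nonneg_left hw2 (sq_nonneg n)
    have m4 := mul_le_mul_of_nonneg_left hu2 (sq_nonneg n)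
    linarith
  -- The zero legs sit in different coordinates, so `A` and `C` are independent and their product
  -- averages to exactly a·c.
  have s4 : ∑ m : Fin 3 → V, A (m 2) * C (m 1) = n ^ 3 * (a * c) := by
    have hA' : ∑ v, A v = n * a := by rw [← hmA, card_mul_finMean]
    have hC' : ∑ v, C v = n * c := by rw [← hmC, card_mul_finMean]
    rw [sum_pi_fin_three]
    simp only [cons_val_one, cons_val_zero, cons_val]
    simp only [← Finset.sum_mul, ← Finset.mul_sum, hA', hC']
    simp [← hn]
    ring
  have hpt : ∀ m, b * (f m * C (m 1)) + A (m 2) * C (m 1) * g m + b * (A (m 2) * h m)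
      - 2 * b * (A (m 2) * C (m 1))
      - (((f m - A (m 2)) ^ 2 + (g m - b) ^ 2) + b * ((f m - A (m 2)) ^ 2 + (h m - C (m 1)) ^ 2)
        + ((g m - b) ^ 2 + (h m - C (m 1)) ^ 2)) / 2 ≤ f m * g m * h m := fun m =>
    mul_mul_ge_of_approx (tensorApply_nonneg hK _ hH0 m) (tensorApply_le_one hK _ hH1 m)
      (marginal_nonneg hF0 _ _) (marginal_le_one hF1 _) hb0
  have hsum := Finset.sum_le_sum fun m (_ : m ∈ Finset.univ) => hpt m
  simp only [Finset.sum_add_distrib, Finset.sum_sub_distrib, ← Finset.mul_sum,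
    ← Finset.sum_div] at hsum
  rw [s4] at hsum
  have m1 := mul_le_mul_of_nonneg_left s1 hb0
  have m2 := mul_le_mul_of_nonneg_left s2 hb0
  have m3 := mul_le_mul_of_nonneg_left r1 hb0
  have m4 := mul_le_mul_of_nonneg_left r3 hb0
  linarith

end Tripod

/-! ### Averaging over the permutations of the coordinates -/

theorem sum_perm_fin_three {M : Type*} [AddCommMonoid M] (Φ : Fin 3 → Fin 3 → Fin 3 → M) :
    ∑ π : Equiv.Perm (Fin 3), Φ (π 0) (π 1) (π 2)
      = Φ 0 1 2 + Φ 0 2 1 + Φ 1 0 2 + Φ 1 2 0 + Φ 2 0 1 + Φ 2 1 0 := by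
  have h : (Finset.univ : Finset (Equiv.Perm (Fin 3)))
      = {1, Equiv.swap 1 2, Equiv.swap 0 1, Equiv.swap 0 1 * Equiv.swap 1 2,
        Equiv.swap 1 2 * Equiv.swap 0 1, Equiv.swap 0 2} := by decide
  rw [h, Finset.sum_insert (by decide), Finset.sum_insert (by decide),
    Finset.sum_insert (by decide), Finset.sum_insert (by decide), Finset.sum_insert (by decide),
    Finset.sum_singleton]
  simp only [← add_assoc]
  rfl

theorem sum_perm_inv_apply (φ : Fin 3 → ℝ) (i : Fin 3) :
    ∑ τ : Equiv.Perm (Fin 3), φ (τ⁻¹ i) = 2 * (φ 0 + φ 1 + φ 2) := by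
  refine (Equiv.sum_comp (Equiv.inv (Equiv.Perm (Fin 3)))
    fun τ : Equiv.Perm (Fin 3) => φ (τ i)).trans ?_
  fin_cases i
  · exact (sum_perm_fin_three fun a _ _ => φ a).trans (by ring)
  · exact (sum_perm_fin_three fun _ b _ => φ b).trans (by ring)
  · exact (sum_perm_fin_three fun _ _ c => φ c).trans (by ring)

section Symmetrization

variable {V : Type*} [Fintype V] [DecidableEq V]

theorem sum_comp_perm {R : Type*} [AddCommMonoid R] (Φ : (Fin 3 → V) → R)
    (τ : Equiv.Perm (Fin 3)) : ∑ x : Fin 3 → V, Φ (x ∘ τ) = ∑ x, Φ x :=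
  Equiv.sum_comp (Equiv.arrowCongr τ.symm (Equiv.refl V)) Φ

theorem finMean_comp_perm (F : (Fin 3 → V) → ℝ) (τ : Equiv.Perm (Fin 3)) :
    finMean (fun x => F (x ∘ τ)) = finMean F := by
  rw [finMean, finMean, sum_comp_perm F τ]

theorem marginal_comp_perm (F : (Fin 3 → V) → ℝ) (τ : Equiv.Perm (Fin 3)) (i : Fin 3) (v : V) :
    marginal (fun x => F (x ∘ τ)) i v = marginal F (τ⁻¹ i) v := by
  rw [marginal, marginal, ← sum_comp_perm (fun x => if x (τ⁻¹ i) = v then F x else 0) τ]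
  simp

theorem marginalVariance_comp_perm (F : (Fin 3 → V) → ℝ) (τ : Equiv.Perm (Fin 3)) (i : Fin 3) :
    marginalVariance (fun x => F (x ∘ τ)) i = marginalVariance F (τ⁻¹ i) := by
  rw [marginalVariance, marginalVariance, finMean_comp_perm]
  simp only [marginal_comp_perm]

variable [Nonempty V] {K : Matrix V V ℝ} {ε : ℝ}

/-- Each marginal occurs for two of the six permutations, and the three variances together are at
most the mean. Bounding each term separately by the mean would lose a factor of three. -/
theorem sum_marginalVariance_comp_perm_le {F : (Fin 3 → V) → ℝ} (hF0 : ∀ x, 0 ≤ F x)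
    (hF1 : ∀ x, F x ≤ 1) (i : Fin 3) :
    ∑ τ : Equiv.Perm (Fin 3), marginalVariance (fun x => F (x ∘ τ)) i ≤ 2 * finMean F := by
  simp only [marginalVariance_comp_perm]
  rw [sum_perm_inv_apply]
  refine mul_le_mul_of_nonneg_left ((sum_marginalVariance_le F).trans ?_) zero_le_two
  exact div_le_div_of_nonneg_right
    (Finset.sum_le_sum fun x _ => by nlinarith [hF0 x, hF1 x]) (Nat.cast_nonneg _)

theorem sum_perm_sum_tensorApply_mul_ge (hK : K.IsContracting ε) (hε0 : 0 < ε) (hε : ε ≤ 1)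
    {F G H : (Fin 3 → V) → ℝ} (hF0 : ∀ x, 0 ≤ F x) (hF1 : ∀ x, F x ≤ 1)
    (hG0 : ∀ x, 0 ≤ G x) (hG1 : ∀ x, G x ≤ 1) (hH0 : ∀ x, 0 ≤ H x) (hH1 : ∀ x, H x ≤ 1)
    {a b c : ℝ} (ha : finMean F = a) (hb : finMean G = b) (hc : finMean H = c) :
    (Fintype.card V : ℝ) ^ 3 * (6 * (a * b * c) - ε ^ 2 * (b * (a + c))
      - 2 * ε * (a * b + b * c + c * a) - ε ^ 2 * (a + c)
      - 3 * ε ^ 2 * (a + 2 * b + c + a * b + b * c))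
    ≤ ∑ τ : Equiv.Perm (Fin 3), ∑ m, tensorApply K ![1, 2, 0] (fun x => F (x ∘ τ)) m
        * tensorApply K ![1, 1, 1] (fun x => G (x ∘ τ)) m
        * tensorApply K ![2, 0, 1] (fun x => H (x ∘ τ)) m := by
  have ha0 : 0 ≤ a := ha ▸ finMean_nonneg hF0
  have hb0 : 0 ≤ b := hb ▸ finMean_nonneg hG0
  have hc0 : 0 ≤ c := hc ▸ finMean_nonneg hH0
  have h := Finset.sum_le_sum fun (τ : Equiv.Perm (Fin 3)) (_ : τ ∈ Finset.univ) =>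
    sum_tensorApply_mul_ge hK hε0 hε (fun x => hF0 (x ∘ τ)) (fun x => hF1 (x ∘ τ))
      (fun x => hG0 (x ∘ τ)) (fun x => hG1 (x ∘ τ)) (fun x => hH0 (x ∘ τ))
      (fun x => hH1 (x ∘ τ)) ((finMean_comp_perm F τ).trans ha)
      ((finMean_comp_perm G τ).trans hb) ((finMean_comp_perm H τ).trans hc)
  refine le_trans ?_ h
  rw [← Finset.mul_sum]
  refine mul_le_mul_of_nonneg_left ?_ (by positivity)
  simp only [Finset.sum_sub_distrib, Finset.sum_add_distrib, ← Finset.mul_sum, ← Finset.sum_div]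
  simp only [Finset.sum_const, Finset.card_univ, Fintype.card_perm, Fintype.card_fin,
    nsmul_eq_mul]
  have f1 := sum_marginalVariance_comp_perm_le hF0 hF1 1
  have f2 := sum_marginalVariance_comp_perm_le hF0 hF1 2
  have g1 := sum_marginalVariance_comp_perm_le hG0 hG1 1
  have g2 := sum_marginalVariance_comp_perm_le hG0 hG1 2
  have h1 := sum_marginalVariance_comp_perm_le hH0 hH1 1
  have h2 := sum_marginalVariance_comp_perm_le hH0 hH1 2
  rw [ha] at f1 f2
  rw [hb] at g1 g2
  rw [hc] at h1 h2
  have e1 : b * (ε ^ 2 * (∑ τ : Equiv.Perm (Fin 3), marginalVariance (fun x => F (x ∘ τ)) 1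
      + ∑ τ : Equiv.Perm (Fin 3), marginalVariance (fun x => H (x ∘ τ)) 1))
      ≤ b * (ε ^ 2 * (2 * a + 2 * c)) := by gcongr
  have e2 : ε * (a * (∑ τ : Equiv.Perm (Fin 3), marginalVariance (fun x => G (x ∘ τ)) 1
      + ∑ τ : Equiv.Perm (Fin 3), marginalVariance (fun x => H (x ∘ τ)) 1)
      + c * (∑ τ : Equiv.Perm (Fin 3), marginalVariance (fun x => G (x ∘ τ)) 2
      + ∑ τ : Equiv.Perm (Fin 3), marginalVariance (fun x => F (x ∘ τ)) 2)
      + b * (∑ τ : Equiv.Perm (Fin 3), marginalVariance (fun x => F (x ∘ τ)) 2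
      + ∑ τ : Equiv.Perm (Fin 3), marginalVariance (fun x => H (x ∘ τ)) 2))
      ≤ ε * (a * (2 * b + 2 * c) + c * (2 * b + 2 * a) + b * (2 * a + 2 * c)) := by gcongr
  have e3 : ε ^ 2 * (∑ τ : Equiv.Perm (Fin 3), marginalVariance (fun x => F (x ∘ τ)) 2
      + ∑ τ : Equiv.Perm (Fin 3), marginalVariance (fun x => H (x ∘ τ)) 1)
      ≤ ε ^ 2 * (2 * a + 2 * c) := by gcongr
  have h6 : ((3 : ℕ).factorial : ℝ) = 6 := by norm_num [Nat.factorial]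
  rw [h6]
  linarith

end Symmetrization

/-! ### Walk weights of tripods -/

/-- The number of ways (weighted by powers of `M`) to join a center to `x`, `y`, `z` by walks of
lengths `p`, `q`, `r`. -/
noncomputable def tripodWeight {V : Type*} [Fintype V] [DecidableEq V] (M : Matrix V V ℝ)
    (p q r : ℕ) (x y z : V) : ℝ :=
  ∑ m, (M ^ p) m x * (M ^ q) m y * (M ^ r) m z

section Weights

variable {V : Type*} [Fintype V] [DecidableEq V]

theorem tripodWeight_smul (c : ℝ) (M : Matrix V V ℝ) (p q r : ℕ) (x y z : V) :
    tripodWeight (c • M) p q r x y z = c ^ (p + q + r) * tripodWeight M p q r x y z := by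
  simp only [tripodWeight, smul_pow, Matrix.smul_apply, smul_eq_mul, Finset.mul_sum]
  exact Finset.sum_congr rfl fun m _ => by ring

/-- Interchanging sums: with the ends fixed, the sum over centers factors over the three
coordinates. -/
theorem sum_tensorApply_mul_eq (K : Matrix V V ℝ) (l l' l'' : Fin 3 → ℕ)
    (F G H : (Fin 3 → V) → ℝ) :
    ∑ m, tensorApply K l F m * tensorApply K l' G m * tensorApply K l'' H m
      = ∑ x, ∑ y, ∑ z, F x * G y * H z
        * ∏ i, tripodWeight K (l i) (l' i) (l'' i) (x i) (y i) (z i) := by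
  simp only [tripodWeight, tensorApply, Fintype.prod_sum, Finset.mul_sum, Finset.sum_mul]
  rw [Finset.sum_comm]
  have e1 : ∀ f : (Fin 3 → V) → (Fin 3 → V) → (Fin 3 → V) → (Fin 3 → V) → ℝ,
      ∑ m, ∑ z, ∑ y, ∑ x, f m z y x = ∑ x, ∑ y, ∑ z, ∑ m, f m z y x := by
    intro f
    calc ∑ m, ∑ z, ∑ y, ∑ x, f m z y x = ∑ m, ∑ x, ∑ y, ∑ z, f m z y x := by
          refine Finset.sum_congr rfl fun m _ => ?_
          rw [Finset.sum_comm, Finset.sum_congr rfl fun y _ => Finset.sum_comm, Finset.sum_comm]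
      _ = ∑ x, ∑ y, ∑ z, ∑ m, f m z y x := by
          rw [Finset.sum_comm]
          refine Finset.sum_congr rfl fun x _ => ?_
          rw [Finset.sum_comm]
          exact Finset.sum_congr rfl fun y _ => Finset.sum_comm
  rw [Finset.sum_comm, e1]
  refine Finset.sum_congr rfl fun x _ => Finset.sum_congr rfl fun y _ =>
    Finset.sum_congr rfl fun z _ => Finset.sum_congr rfl fun m _ => ?_
  rw [Finset.prod_mul_distrib, Finset.prod_mul_distrib]
  ring

end Weights

/-! ### Degenerate tripods in one coordinate -/

namespace SimpleGraph

section Rows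

variable {V : Type*} [Fintype V] [DecidableEq V] (G : SimpleGraph V) [DecidableRel G.Adj]

theorem adjMatrix_pow_nonneg (j : ℕ) (x y : V) : 0 ≤ (G.adjMatrix ℝ ^ j) x y := by
  induction j generalizing x y with
  | zero => rw [pow_zero, one_apply]; split_ifs <;> norm_num
  | succ j ih =>
    rw [pow_succ, mul_apply]
    refine Finset.sum_nonneg fun z _ => mul_nonneg (ih x z) ?_
    rw [adjMatrix_apply]; split_ifs <;> norm_num

theorem tripodWeight_nonneg (p q r : ℕ) (x y z : V) :
    0 ≤ tripodWeight (G.adjMatrix ℝ) p q r x y z :=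
  Finset.sum_nonneg fun m _ => mul_nonneg (mul_nonneg (G.adjMatrix_pow_nonneg p m x)
    (G.adjMatrix_pow_nonneg q m y)) (G.adjMatrix_pow_nonneg r m z)

theorem adjMatrix_symm (x y : V) : G.adjMatrix ℝ x y = G.adjMatrix ℝ y x := by
  simp only [adjMatrix_apply, G.adj_comm]

variable {G} {d : ℕ}

theorem IsRegularOfDegree.sum_adjMatrix (hreg : G.IsRegularOfDegree d) (x : V) :
    ∑ y, G.adjMatrix ℝ x y = d := by
  simp only [adjMatrix_apply, Finset.sum_boole]
  rw [← hreg x, ← card_neighborFinset_eq_degree, neighborFinset_eq_filter]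

theorem IsRegularOfDegree.sum_adjMatrix_pow (hreg : G.IsRegularOfDegree d) (j : ℕ) (x : V) :
    ∑ y, (G.adjMatrix ℝ ^ j) x y = (d : ℝ) ^ j := by
  induction j generalizing x with
  | zero => simp [one_apply]
  | succ j ih =>
    simp only [pow_succ, mul_apply]
    rw [Finset.sum_comm]
    simp only [← Finset.mul_sum, hreg.sum_adjMatrix, ← Finset.sum_mul, ih]

theorem adjMatrix_pow_symm (j : ℕ) (x y : V) :
    (G.adjMatrix ℝ ^ j) x y = (G.adjMatrix ℝ ^ j) y x := by
  have : ((G.adjMatrix ℝ) ^ j)ᵀ = (G.adjMatrix ℝ) ^ j := by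
    rw [transpose_pow, transpose_adjMatrix]
  conv_lhs => rw [← this]
  rfl

theorem IsRegularOfDegree.sum_adjMatrix_pow' (hreg : G.IsRegularOfDegree d) (j : ℕ) (y : V) :
    ∑ x, (G.adjMatrix ℝ ^ j) x y = (d : ℝ) ^ j := by
  rw [← hreg.sum_adjMatrix_pow j y]
  exact Finset.sum_congr rfl fun x _ => adjMatrix_pow_symm j x y

theorem IsRegularOfDegree.sum_tripodWeight (hreg : G.IsRegularOfDegree d) (p q r : ℕ) (x : V) :
    ∑ y, ∑ z, tripodWeight (G.adjMatrix ℝ) p q r x y z = (d : ℝ) ^ (p + q + r) := by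
  simp only [tripodWeight]
  rw [Finset.sum_congr rfl fun y _ => Finset.sum_comm, Finset.sum_comm]
  simp only [← Finset.mul_sum, hreg.sum_adjMatrix_pow, ← Finset.sum_mul, hreg.sum_adjMatrix_pow']
  ring

/-- Two distinct vertices are joined by at most one walk of length two. -/
theorem adjMatrix_sq_eq_zero_or (hg : 9 < G.egirth) {x y : V} (hxy : x ≠ y) :
    (G.adjMatrix ℝ ^ 2) x y = 0 ∨
      (G.adjMatrix ℝ ^ 2) x y = 1 ∧ ∃ s, G.Adj x s ∧ G.Adj s y := by
  have hval : (G.adjMatrix ℝ ^ 2) x y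
      = ∑ s, if G.Adj x s ∧ G.Adj s y then (1 : ℝ) else 0 := by
    rw [pow_two, mul_apply]
    refine Finset.sum_congr rfl fun s _ => ?_
    simp only [adjMatrix_apply]
    split_ifs <;> simp_all
  by_cases h : ∃ s, G.Adj x s ∧ G.Adj s y
  · obtain ⟨s, hs⟩ := h
    refine Or.inr ⟨?_, s, hs⟩
    rw [hval, Finset.sum_eq_single s, if_pos hs]
    · intro t _ hts
      rw [if_neg]
      exact fun ht => hts (common_neighbor_unique hg hxy ht.1 ht.2 hs.1 hs.2)
    · simp
  · left
    rw [hval]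
    refine Finset.sum_eq_zero fun s _ => if_neg fun hs => h ⟨s, hs⟩

theorem IsRegularOfDegree.adjMatrix_sq_self (hreg : G.IsRegularOfDegree d) (x : V) :
    (G.adjMatrix ℝ ^ 2) x x = d := by
  rw [pow_two, adjMatrix_mul_self_apply_self, hreg x]

open Classical in
/-- The indicator of prescribed distances between three vertices. -/
noncomputable def distanceIndicator (G : SimpleGraph V) (a b c : ℕ) (x y z : V) : ℝ :=
  if G.edist x y = a ∧ G.edist x z = b ∧ G.edist y z = c then 1 else 0

theorem distanceIndicator_nonneg (a b c : ℕ) (x y z : V) :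
    0 ≤ distanceIndicator G a b c x y z := by
  rw [distanceIndicator]; split_ifs <;> norm_num

/-- The degenerate tripods with legs `(0, 1, 1)`. -/
noncomputable def degenerate₀₁₁ (G : SimpleGraph V) [DecidableRel G.Adj] (x y z : V) : ℝ :=
  G.adjMatrix ℝ x y * if y = z then 1 else 0

/-- The center is x, and the two edges form a geodesic unless y = z. -/
theorem tripodWeight_zero_one_one_le (hg : 9 < G.egirth) (x y z : V) :
    tripodWeight (G.adjMatrix ℝ) 0 1 1 x y z
      ≤ distanceIndicator G 1 1 2 x y z + degenerate₀₁₁ G x y z := by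
  have hw : tripodWeight (G.adjMatrix ℝ) 0 1 1 x y z
      = G.adjMatrix ℝ x y * G.adjMatrix ℝ x z := by
    simp only [tripodWeight, pow_zero, one_apply, pow_one]
    simp only [ite_mul, one_mul, zero_mul, Finset.sum_ite_eq', Finset.mem_univ, if_true]
  rw [hw, degenerate₀₁₁]
  by_cases hxy : G.Adj x y
  · by_cases hxz : G.Adj x z
    · by_cases hyz : y = z
      · subst hyz
        have := distanceIndicator_nonneg (G := G) 1 1 2 x y y
        simp [hxy, this]
      · rw [distanceIndicator, if_pos ⟨by simpa using hxy, by simpa using hxz,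
          edist_eq_two hg hxy.symm hxz hyz⟩]
        simp [hxy, hxz, hyz]
    · have := distanceIndicator_nonneg (G := G) 1 1 2 x y z
      simp only [adjMatrix_apply, hxy, hxz, if_true, if_false]
      split_ifs <;> linarith
  · have := distanceIndicator_nonneg (G := G) 1 1 2 x y z
    simp [hxy, this]

theorem IsRegularOfDegree.sum_degenerate₀₁₁ (hreg : G.IsRegularOfDegree d) (x : V) :
    ∑ y, ∑ z, degenerate₀₁₁ G x y z = d := by
  simp only [degenerate₀₁₁, mul_ite, mul_one, mul_zero, Finset.sum_ite_eq, Finset.mem_univ, if_true,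
    hreg.sum_adjMatrix]

theorem degenerate₀₁₁_nonneg (x y z : V) : 0 ≤ degenerate₀₁₁ G x y z := by
  simp only [degenerate₀₁₁, adjMatrix_apply]
  split_ifs <;> norm_num

/-- The degenerate tripods with legs `(2, 1, 0)`. -/
noncomputable def degenerate₂₁₀ (G : SimpleGraph V) [DecidableRel G.Adj] (d : ℕ) (x y z : V) : ℝ :=
  (if x = z then (d : ℝ) * G.adjMatrix ℝ z y else 0) + G.adjMatrix ℝ z y * G.adjMatrix ℝ y x

theorem adjMatrix_nonneg (x y : V) : 0 ≤ G.adjMatrix ℝ x y := by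
  rw [adjMatrix_apply]; split_ifs <;> norm_num

theorem degenerate₂₁₀_nonneg (x y z : V) : 0 ≤ degenerate₂₁₀ G d x y z := by
  have h1 := adjMatrix_nonneg (G := G) z y
  have h2 := adjMatrix_nonneg (G := G) y x
  rw [degenerate₂₁₀]
  split_ifs <;> positivity

/-- The center is z. Degeneracy means that the walk of length 2 to x returns to z, in d ways, or
passes through y. -/
theorem tripodWeight_two_one_zero_le (hg : 9 < G.egirth) (hreg : G.IsRegularOfDegree d)
    (x y z : V) :
    tripodWeight (G.adjMatrix ℝ) 2 1 0 x y z
      ≤ distanceIndicator G 3 2 1 x y z + degenerate₂₁₀ G d x y z := by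
  have hw : tripodWeight (G.adjMatrix ℝ) 2 1 0 x y z
      = (G.adjMatrix ℝ ^ 2) z x * G.adjMatrix ℝ z y := by
    simp only [tripodWeight, pow_zero, one_apply, pow_one]
    simp
  have hI := distanceIndicator_nonneg (G := G) 3 2 1 x y z
  have hb := degenerate₂₁₀_nonneg (G := G) (d := d) x y z
  rw [hw]
  by_cases hzy : G.Adj z y
  · by_cases hxz : x = z
    · subst hxz
      rw [hreg.adjMatrix_sq_self, degenerate₂₁₀, if_pos rfl]
      have h1 := adjMatrix_nonneg (G := G) x y
      have h2 := adjMatrix_nonneg (G := G) y x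
      have := mul_nonneg h1 h2
      linarith
    · rcases adjMatrix_sq_eq_zero_or hg (Ne.symm hxz) with h | ⟨h, s, hs1, hs2⟩
      · rw [h]; linarith
      · rw [h]
        by_cases hsy : s = y
        · subst hsy
          rw [degenerate₂₁₀, if_neg hxz]
          simp [hs1, hs2, hI]
        · rw [distanceIndicator, if_pos ⟨edist_eq_three hg hs2.symm hs1.symm hzy hxz hsy,
            edist_eq_two hg hs2.symm hs1.symm hxz, by simpa using hzy.symm⟩]
          simp [hzy, hb]
  · have : G.adjMatrix ℝ z y = 0 := by simp [hzy]
    rw [this]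
    linarith

theorem IsRegularOfDegree.sum_degenerate₂₁₀ (hreg : G.IsRegularOfDegree d) (x : V) :
    ∑ y, ∑ z, degenerate₂₁₀ G d x y z = 2 * (d : ℝ) ^ 2 := by
  have e1 : ∑ y, ∑ z, (if x = z then (d : ℝ) * G.adjMatrix ℝ z y else 0) = (d : ℝ) ^ 2 := by
    simp only [Finset.sum_ite_eq, Finset.mem_univ, if_true, ← Finset.mul_sum, hreg.sum_adjMatrix]
    ring
  have e2 : ∑ y, ∑ z, G.adjMatrix ℝ z y * G.adjMatrix ℝ y x = (d : ℝ) ^ 2 := by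
    simp only [← Finset.sum_mul, fun y z => adjMatrix_symm G z y, hreg.sum_adjMatrix,
      ← Finset.mul_sum]
    ring
  simp only [degenerate₂₁₀, Finset.sum_add_distrib, e1, e2]
  ring

/-- The degenerate tripods with legs `(1, 1, 2)`. -/
noncomputable def degenerate₁₁₂ (G : SimpleGraph V) [DecidableRel G.Adj] (d : ℕ) (x y z : V) : ℝ :=
  (if x = y then (G.adjMatrix ℝ ^ 3) x z else 0)
    + (d : ℝ) * (G.adjMatrix ℝ z x * G.adjMatrix ℝ z y)
    + (G.adjMatrix ℝ ^ 2) x y * G.adjMatrix ℝ x z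
    + (G.adjMatrix ℝ ^ 2) x y * G.adjMatrix ℝ y z

theorem degenerate₁₁₂_nonneg (x y z : V) : 0 ≤ degenerate₁₁₂ G d x y z := by
  have h1 := adjMatrix_nonneg (G := G) z x
  have h2 := adjMatrix_nonneg (G := G) z y
  have h3 := adjMatrix_nonneg (G := G) x z
  have h4 := adjMatrix_nonneg (G := G) y z
  have h5 := G.adjMatrix_pow_nonneg 3 x z
  have h6 := G.adjMatrix_pow_nonneg 2 x y
  rw [degenerate₁₁₂]
  split_ifs <;> positivity

theorem IsRegularOfDegree.sum_degenerate₁₁₂ (hreg : G.IsRegularOfDegree d) (x : V) :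
    ∑ y, ∑ z, degenerate₁₁₂ G d x y z = 4 * (d : ℝ) ^ 3 := by
  have e1 : ∑ y, ∑ z, (if x = y then (G.adjMatrix ℝ ^ 3) x z else 0) = (d : ℝ) ^ 3 := by
    rw [Finset.sum_comm]
    simp [hreg.sum_adjMatrix_pow]
  have e2 : ∑ y, ∑ z, (d : ℝ) * (G.adjMatrix ℝ z x * G.adjMatrix ℝ z y) = (d : ℝ) ^ 3 := by
    rw [Finset.sum_comm]
    simp only [← Finset.mul_sum, hreg.sum_adjMatrix, ← Finset.sum_mul]
    simp only [fun z => adjMatrix_symm G z x, hreg.sum_adjMatrix]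
    ring
  have e3 : ∑ y, ∑ z, (G.adjMatrix ℝ ^ 2) x y * G.adjMatrix ℝ x z = (d : ℝ) ^ 3 := by
    simp only [← Finset.mul_sum, hreg.sum_adjMatrix, ← Finset.sum_mul, hreg.sum_adjMatrix_pow]
    ring
  have e4 : ∑ y, ∑ z, (G.adjMatrix ℝ ^ 2) x y * G.adjMatrix ℝ y z = (d : ℝ) ^ 3 := by
    simp only [← Finset.mul_sum, hreg.sum_adjMatrix, ← Finset.sum_mul, hreg.sum_adjMatrix_pow]
    ring
  simp only [degenerate₁₁₂, Finset.sum_add_distrib, e1, e2, e3, e4]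
  ring

/-- Four degenerations, one for each summand: x = y, the walk from the center to z is closed, or it
passes through x or through y. Otherwise the center is the unique common neighbor of x and y, and
all connecting paths are geodesics. -/
theorem tripodWeight_one_one_two_le (hg : 9 < G.egirth) (hreg : G.IsRegularOfDegree d)
    (x y z : V) :
    tripodWeight (G.adjMatrix ℝ) 1 1 2 x y z
      ≤ distanceIndicator G 2 3 3 x y z + degenerate₁₁₂ G d x y z := by
  have hI := distanceIndicator_nonneg (G := G) 2 3 3 x y z
  have h1 := adjMatrix_nonneg (G := G) z x
  have h2 := adjMatrix_nonneg (G := G) z y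
  have h3 := adjMatrix_nonneg (G := G) x z
  have h4 := adjMatrix_nonneg (G := G) y z
  have h5 := G.adjMatrix_pow_nonneg 3 x z
  have h6 := G.adjMatrix_pow_nonneg 2 x y
  have hd : (0 : ℝ) ≤ d := Nat.cast_nonneg d
  have k2 := mul_nonneg hd (mul_nonneg h1 h2)
  have k3 := mul_nonneg h6 h3
  have k4 := mul_nonneg h6 h4
  by_cases hxy : x = y
  · subst hxy
    have hle : tripodWeight (G.adjMatrix ℝ) 1 1 2 x x z ≤ (G.adjMatrix ℝ ^ 3) x z := by
      rw [pow_succ', mul_apply, tripodWeight]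
      refine Finset.sum_le_sum fun m _ => ?_
      rw [pow_one, adjMatrix_symm G x m]
      refine mul_le_mul_of_nonneg_right ?_ (G.adjMatrix_pow_nonneg 2 m z)
      rw [adjMatrix_apply]; split_ifs <;> norm_num
    rw [degenerate₁₁₂, if_pos rfl]
    linarith
  · rw [degenerate₁₁₂, if_neg hxy]
    rcases adjMatrix_sq_eq_zero_or hg hxy with h | ⟨h, m, hm1, hm2⟩
    · have hz : tripodWeight (G.adjMatrix ℝ) 1 1 2 x y z = 0 := by
        rw [tripodWeight]
        have hs : ∑ m, G.adjMatrix ℝ x m * G.adjMatrix ℝ m y = 0 := by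
          rw [← mul_apply, ← pow_two, h]
        have := (Finset.sum_eq_zero_iff_of_nonneg fun m _ =>
          mul_nonneg (adjMatrix_nonneg x m) (adjMatrix_nonneg m y)).1 hs
        refine Finset.sum_eq_zero fun m _ => ?_
        rw [pow_one, adjMatrix_symm G m x, this m (Finset.mem_univ _), zero_mul]
      rw [hz]
      linarith
    · have hw : tripodWeight (G.adjMatrix ℝ) 1 1 2 x y z = (G.adjMatrix ℝ ^ 2) m z := by
        rw [tripodWeight, Finset.sum_eq_single m]
        · simp [hm1.symm, hm2]
        · intro t _ htm
          rw [pow_one]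
          by_cases ht1 : G.Adj t x
          · by_cases ht2 : G.Adj t y
            · exact absurd (common_neighbor_unique hg hxy ht1.symm ht2 hm1 hm2) htm
            · simp [ht2]
          · simp [ht1]
        · simp
      rw [hw, h]
      rw [h] at k3 k4
      by_cases hmz : m = z
      · subst hmz
        rw [hreg.adjMatrix_sq_self]
        simp only [adjMatrix_apply, hm1.symm, hm2, if_true] at k3 k4 ⊢
        linarith
      · rcases adjMatrix_sq_eq_zero_or hg hmz with h' | ⟨h', s, hs1, hs2⟩
        · rw [h']; linarith
        · rw [h']
          by_cases hsx : s = x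
          · subst hsx
            have : G.adjMatrix ℝ s z = 1 := by simp [hs2]
            rw [this] at k3 ⊢
            linarith
          · by_cases hsy : s = y
            · subst hsy
              have : G.adjMatrix ℝ s z = 1 := by simp [hs2]
              rw [this] at k4 ⊢
              linarith
            · rw [distanceIndicator, if_pos ⟨edist_eq_two hg hm1 hm2 hxy,
                edist_eq_three hg hm1 hs1 hs2 (Ne.symm hsx) hmz,
                edist_eq_three hg hm2.symm hs1 hs2 (Ne.symm hsy) hmz⟩]
              linarith

end Rows

end SimpleGraph

theorem sum_sum_prod_fin_three {V : Type*} [Fintype V] [DecidableEq V] (φ₀ φ₁ φ₂ : V → V → ℝ) :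
    ∑ y : Fin 3 → V, ∑ z : Fin 3 → V, φ₀ (y 0) (z 0) * φ₁ (y 1) (z 1) * φ₂ (y 2) (z 2)
      = (∑ v, ∑ w, φ₀ v w) * (∑ v, ∑ w, φ₁ v w) * ∑ v, ∑ w, φ₂ v w := by
  have h := Fintype.prod_sum (κ := fun _ : Fin 3 => V)
    fun i v => ∑ w, (![φ₀, φ₁, φ₂] : Fin 3 → V → V → ℝ) i v w
  rw [Fin.prod_univ_three] at h
  refine (h.trans ?_).symm
  refine Finset.sum_congr rfl fun y _ => ?_
  rw [Fintype.prod_sum]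
  exact Finset.sum_congr rfl fun z _ => by rw [Fin.prod_univ_three]; rfl

/-! ### From weighted tripods to distance patterns -/

namespace SimpleGraph

section LowerBound

variable {V : Type*} [Fintype V] [DecidableEq V] {G : SimpleGraph V} [DecidableRel G.Adj] {d : ℕ}

theorem IsRegularOfDegree.isContracting [Nonempty V] (hreg : G.IsRegularOfDegree d) (hd : 0 < d)
    {ε : ℝ} (hε : ε < 1) (hspec : secondEigenvalue G ≤ ε * d) :
    ((d : ℝ)⁻¹ • G.adjMatrix ℝ).IsContracting ε where
  symm x y := by rw [Matrix.smul_apply, Matrix.smul_apply, adjMatrix_symm]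
  nonneg x y := by
    rw [Matrix.smul_apply]
    exact smul_nonneg (by positivity) (adjMatrix_nonneg x y)
  sum_eq_one x := by
    have : (d : ℝ) ≠ 0 := by exact_mod_cast hd.ne'
    simp only [Matrix.smul_apply, smul_eq_mul, ← Finset.mul_sum, hreg.sum_adjMatrix]
    exact inv_mul_cancel₀ this
  contract φ hφ := by
    have hd' : (0 : ℝ) < d := by exact_mod_cast hd
    have hV : 2 ≤ Fintype.card V := by
      have x : V := Classical.arbitrary V
      have := G.degree_lt_card_verts x
      rw [hreg x] at this
      omega
    have h := sum_sq_adjMatrix_mulVec_le G d hreg hV (ε * d) hspec (by nlinarith) φ hφ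
    simp only [smul_mulVec, Pi.smul_apply, smul_eq_mul, mul_pow, ← Finset.mul_sum]
    calc ((d : ℝ)⁻¹) ^ 2 * ∑ v, (G.adjMatrix ℝ *ᵥ φ) v ^ 2
        ≤ ((d : ℝ)⁻¹) ^ 2 * ((ε * d) ^ 2 * ∑ v, φ v ^ 2) :=
          mul_le_mul_of_nonneg_left h (by positivity)
      _ = ε ^ 2 * ∑ v, φ v ^ 2 := by field_simp

/-- The indicator of the distance pattern of a nondegenerate tripod. -/
noncomputable def patternIndicator (G : SimpleGraph V) (x y z : Fin 3 → V) : ℝ :=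
  distanceIndicator G 2 3 3 (x 0) (y 0) (z 0) * distanceIndicator G 3 2 1 (x 1) (y 1) (z 1)
    * distanceIndicator G 1 1 2 (x 2) (y 2) (z 2)

/-- The weight of the degenerate tripods. -/
noncomputable def degenerateWeight (G : SimpleGraph V) [DecidableRel G.Adj] (d : ℕ)
    (x y z : Fin 3 → V) : ℝ :=
  degenerate₁₁₂ G d (x 0) (y 0) (z 0) * tripodWeight (G.adjMatrix ℝ) 2 1 0 (x 1) (y 1) (z 1)
      * tripodWeight (G.adjMatrix ℝ) 0 1 1 (x 2) (y 2) (z 2)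
    + tripodWeight (G.adjMatrix ℝ) 1 1 2 (x 0) (y 0) (z 0) * degenerate₂₁₀ G d (x 1) (y 1) (z 1)
      * tripodWeight (G.adjMatrix ℝ) 0 1 1 (x 2) (y 2) (z 2)
    + tripodWeight (G.adjMatrix ℝ) 1 1 2 (x 0) (y 0) (z 0)
      * tripodWeight (G.adjMatrix ℝ) 2 1 0 (x 1) (y 1) (z 1) * degenerate₀₁₁ G (x 2) (y 2) (z 2)

theorem degenerateWeight_nonneg (x y z : Fin 3 → V) : 0 ≤ degenerateWeight G d x y z := by
  have := tripodWeight_nonneg G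
  have := degenerate₀₁₁_nonneg (G := G) (x 2) (y 2) (z 2)
  have := degenerate₂₁₀_nonneg (G := G) (d := d) (x 1) (y 1) (z 1)
  have := degenerate₁₁₂_nonneg (G := G) (d := d) (x 0) (y 0) (z 0)
  have := tripodWeight_nonneg G 1 1 2 (x 0) (y 0) (z 0)
  have := tripodWeight_nonneg G 2 1 0 (x 1) (y 1) (z 1)
  have := tripodWeight_nonneg G 0 1 1 (x 2) (y 2) (z 2)
  rw [degenerateWeight]
  positivity

/-- The coordinates have total weights d⁴, d³, d² and degenerate parts 4d³, 2d², d, so the constant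
is 4 + 2 + 1. -/
theorem IsRegularOfDegree.sum_degenerateWeight (hreg : G.IsRegularOfDegree d) (x : Fin 3 → V) :
    ∑ y, ∑ z, degenerateWeight G d x y z = 7 * (d : ℝ) ^ 8 := by
  simp only [degenerateWeight, Finset.sum_add_distrib]
  rw [sum_sum_prod_fin_three (degenerate₁₁₂ G d (x 0)) (tripodWeight _ 2 1 0 (x 1))
      (tripodWeight _ 0 1 1 (x 2)),
    sum_sum_prod_fin_three (tripodWeight _ 1 1 2 (x 0)) (degenerate₂₁₀ G d (x 1))
      (tripodWeight _ 0 1 1 (x 2)),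
    sum_sum_prod_fin_three (tripodWeight _ 1 1 2 (x 0)) (tripodWeight _ 2 1 0 (x 1))
      (degenerate₀₁₁ G (x 2)), hreg.sum_degenerate₀₁₁, hreg.sum_degenerate₂₁₀,
    hreg.sum_degenerate₁₁₂, hreg.sum_tripodWeight, hreg.sum_tripodWeight, hreg.sum_tripodWeight]
  ring

/-- Telescoping after replacing each g by m = min(w, g). This keeps the error terms in w and b only,
whose total sums are known exactly. -/
theorem mul_mul_le_of_le_add {w₀ w₁ w₂ g₀ g₁ g₂ b₀ b₁ b₂ : ℝ} (hw₀ : 0 ≤ w₀) (hw₁ : 0 ≤ w₁)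
    (hw₂ : 0 ≤ w₂) (hg₀ : 0 ≤ g₀) (hg₁ : 0 ≤ g₁) (hg₂ : 0 ≤ g₂) (hb₀ : 0 ≤ b₀) (hb₁ : 0 ≤ b₁)
    (hb₂ : 0 ≤ b₂) (h₀ : w₀ ≤ g₀ + b₀) (h₁ : w₁ ≤ g₁ + b₁) (h₂ : w₂ ≤ g₂ + b₂) :
    w₀ * w₁ * w₂ ≤ g₀ * g₁ * g₂ + (b₀ * w₁ * w₂ + w₀ * b₁ * w₂ + w₀ * w₁ * b₂) := by
  have key : ∀ {w g b : ℝ}, 0 ≤ w → 0 ≤ g → 0 ≤ b → w ≤ g + b →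
      ∃ m, 0 ≤ m ∧ m ≤ w ∧ m ≤ g ∧ w ≤ m + b := by
    intro w g b hw hg hb h
    refine ⟨min w g, le_min hw hg, min_le_left _ _, min_le_right _ _, ?_⟩
    rcases min_choice w g with e | e <;> rw [e] <;> linarith
  obtain ⟨m₀, p0, p1, p2, p3⟩ := key hw₀ hg₀ hb₀ h₀
  obtain ⟨m₁, q0, q1, q2, q3⟩ := key hw₁ hg₁ hb₁ h₁
  obtain ⟨m₂, r0, r1, r2, r3⟩ := key hw₂ hg₂ hb₂ h₂
  have s1 : w₀ * (w₁ * w₂) ≤ (m₀ + b₀) * (w₁ * w₂) :=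
    mul_le_mul_of_nonneg_right p3 (mul_nonneg hw₁ hw₂)
  have s2 : m₀ * w₁ * w₂ ≤ m₀ * (m₁ + b₁) * w₂ := by gcongr
  have s3 : m₀ * m₁ * w₂ ≤ m₀ * m₁ * (m₂ + b₂) := by gcongr
  have s4 : m₀ * m₁ * m₂ ≤ g₀ * g₁ * g₂ := by gcongr
  have s5 : m₀ * b₁ * w₂ ≤ w₀ * b₁ * w₂ := by gcongr
  have s6 : m₀ * m₁ * b₂ ≤ w₀ * w₁ * b₂ := by gcongr
  linarith

/-- Up to degenerate tripods, weighted tripods are counted by the distance pattern of their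
ends. -/
theorem tripod_sum_le_pattern_sum (hg : 9 < G.egirth) (hreg : G.IsRegularOfDegree d) (hd : 0 < d)
    {F₀ F₁ F₂ : (Fin 3 → V) → ℝ} (h0 : ∀ x, 0 ≤ F₀ x) (h1 : ∀ x, 0 ≤ F₁ x) (h2 : ∀ x, 0 ≤ F₂ x)
    (h1' : ∀ x, F₁ x ≤ 1) (h2' : ∀ x, F₂ x ≤ 1) :
    (d : ℝ) ^ 9 * ∑ m, tensorApply ((d : ℝ)⁻¹ • G.adjMatrix ℝ) ![1, 2, 0] F₀ m
        * tensorApply ((d : ℝ)⁻¹ • G.adjMatrix ℝ) ![1, 1, 1] F₁ m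
        * tensorApply ((d : ℝ)⁻¹ • G.adjMatrix ℝ) ![2, 0, 1] F₂ m
      ≤ ∑ x, ∑ y, ∑ z, F₀ x * F₁ y * F₂ z * patternIndicator G x y z
        + 7 * (d : ℝ) ^ 8 * ∑ x, F₀ x := by
  have hd' : (d : ℝ) ≠ 0 := by exact_mod_cast hd.ne'
  rw [sum_tensorApply_mul_eq]
  simp only [Fin.prod_univ_three, tripodWeight_smul, cons_val_zero, cons_val_one, cons_val]
  -- In the error term F₁ and F₂ are bounded by 1, so the free sum over y and z is the total
  -- degenerate weight.
  have e : 7 * (d : ℝ) ^ 8 * ∑ x, F₀ x = ∑ x, ∑ y, ∑ z, F₀ x * degenerateWeight G d x y z := by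
    simp only [← Finset.mul_sum, hreg.sum_degenerateWeight]
    rw [← Finset.sum_mul]
    ring
  rw [e]
  simp only [Finset.mul_sum, ← Finset.sum_add_distrib]
  refine Finset.sum_le_sum fun x _ => Finset.sum_le_sum fun y _ => Finset.sum_le_sum fun z _ => ?_
  have hpt := mul_mul_le_of_le_add (tripodWeight_nonneg G 1 1 2 (x 0) (y 0) (z 0))
    (tripodWeight_nonneg G 2 1 0 (x 1) (y 1) (z 1)) (tripodWeight_nonneg G 0 1 1 (x 2) (y 2) (z 2))
    (distanceIndicator_nonneg _ _ _ _ _ _) (distanceIndicator_nonneg _ _ _ _ _ _)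
    (distanceIndicator_nonneg _ _ _ _ _ _) (degenerate₁₁₂_nonneg _ _ _)
    (degenerate₂₁₀_nonneg _ _ _) (degenerate₀₁₁_nonneg _ _ _)
    (tripodWeight_one_one_two_le hg hreg (x 0) (y 0) (z 0))
    (tripodWeight_two_one_zero_le hg hreg (x 1) (y 1) (z 1))
    (tripodWeight_zero_one_one_le hg (x 2) (y 2) (z 2))
  have hF : 0 ≤ F₀ x * F₁ y * F₂ z := mul_nonneg (mul_nonneg (h0 x) (h1 y)) (h2 z)
  have hF' : F₀ x * F₁ y * F₂ z ≤ F₀ x := by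
    calc F₀ x * F₁ y * F₂ z ≤ F₀ x * 1 * 1 := by
          gcongr
          · exact h2 z
          · exact mul_nonneg (h0 x) zero_le_one
          · exact h0 x
          · exact h1' y
          · exact h2' z
      _ = F₀ x := by ring
  have h3 := mul_le_mul_of_nonneg_left hpt hF
  have h4 := mul_le_mul_of_nonneg_right hF' (degenerateWeight_nonneg (G := G) (d := d) x y z)
  rw [patternIndicator]
  rw [degenerateWeight] at h4 ⊢
  calc _ = F₀ x * F₁ y * F₂ z * (tripodWeight (G.adjMatrix ℝ) 1 1 2 (x 0) (y 0) (z 0)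
        * tripodWeight (G.adjMatrix ℝ) 2 1 0 (x 1) (y 1) (z 1)
        * tripodWeight (G.adjMatrix ℝ) 0 1 1 (x 2) (y 2) (z 2)) := by
        have hdd : (d : ℝ) ^ 9 * ((d : ℝ)⁻¹ ^ (1 + 1 + 2) * (d : ℝ)⁻¹ ^ (2 + 1 + 0)
            * (d : ℝ)⁻¹ ^ (0 + 1 + 1)) = 1 := by
          rw [← pow_add, ← pow_add, inv_pow]
          exact mul_inv_cancel₀ (pow_ne_zero 9 hd')
        linear_combination (F₀ x * F₁ y * F₂ z
          * (tripodWeight (G.adjMatrix ℝ) 1 1 2 (x 0) (y 0) (z 0)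
          * tripodWeight (G.adjMatrix ℝ) 2 1 0 (x 1) (y 1) (z 1)
          * tripodWeight (G.adjMatrix ℝ) 0 1 1 (x 2) (y 2) (z 2))) * hdd
    _ ≤ _ := by linarith

end LowerBound

end SimpleGraph

/-! ### Tripod patterns and triangles of the polygraph -/

/-- The leg lengths of a tripod, indexed by the end point and the coordinate. -/
def tripodLegs : Fin 3 → Fin 3 → ℕ := ![![1, 2, 0], ![1, 1, 1], ![2, 0, 1]]

/-- The distances between the end points of a tripod. -/
def tripodDist (r s i : Fin 3) : ℕ := if r = s then 0 else tripodLegs r i + tripodLegs s i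

/-- The tripod has no symmetries. Hence the 36 choices of roles and coordinate permutation give
different patterns, and a triangle is counted at most once. -/
theorem tripodDist_rigid : ∀ σ ρ : Equiv.Perm (Fin 3),
    (∀ r s i, tripodDist (σ r) (σ s) (ρ i) = tripodDist r s i) → σ = 1 ∧ ρ = 1 := by
  decide

theorem map_tripodDist : ∀ (ρ : Equiv.Perm (Fin 3)) (r s : Fin 3), r ≠ s →
    (Finset.univ : Finset (Fin 3)).val.map (fun i => tripodDist r s (ρ i)) = {1, 2, 3} := by
  decide

namespace SimpleGraph

section Pattern

variable {V : Type*} {G : SimpleGraph V}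

/-- The distances between the three points `Y 0`, `Y 1`, `Y 2` are those of a tripod, up to the
permutation `τ` of the coordinates. -/
def IsTripodPattern (G : SimpleGraph V) (τ : Equiv.Perm (Fin 3)) (Y : Fin 3 → Fin 3 → V) : Prop :=
  ∀ r s i, G.edist (Y r (τ i)) (Y s (τ i)) = tripodDist r s i

theorem IsTripodPattern.unique {X : Fin 3 → Fin 3 → V} {π τ π' τ' : Equiv.Perm (Fin 3)}
    (h : G.IsTripodPattern τ (X ∘ π)) (h' : G.IsTripodPattern τ' (X ∘ π')) : π = π' ∧ τ = τ' := by
  have key := tripodDist_rigid (π'⁻¹ * π) (τ'⁻¹ * τ) fun r s i => by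
    have h1 := h r s i
    have h2 := h' ((π'⁻¹ * π) r) ((π'⁻¹ * π) s) ((τ'⁻¹ * τ) i)
    have hπ : ∀ k, π' (π'⁻¹ k) = k := fun k => π'.apply_symm_apply k
    have hτ : ∀ k, τ' (τ'⁻¹ k) = k := fun k => τ'.apply_symm_apply k
    simp only [Function.comp_apply, Equiv.Perm.mul_apply, hπ, hτ] at h1 h2 ⊢
    rw [h1] at h2
    exact_mod_cast h2.symm
  exact ⟨(inv_mul_eq_one.1 key.1).symm, (inv_mul_eq_one.1 key.2).symm⟩

theorem IsTripodPattern.adj_polygraph {X : Fin 3 → Fin 3 → V} {π τ : Equiv.Perm (Fin 3)}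
    (h : G.IsTripodPattern τ (X ∘ π)) {r s : Fin 3} (hrs : r ≠ s) :
    (polygraph G {1, 2, 3}).Adj (X r) (X s) := by
  have hval : ∀ i, G.edist (X r i) (X s i) = tripodDist (π⁻¹ r) (π⁻¹ s) (τ⁻¹ i) := fun i => by
    have := h (π⁻¹ r) (π⁻¹ s) (τ⁻¹ i)
    simpa using this
  have hne : π⁻¹ r ≠ π⁻¹ s := fun e => hrs (π⁻¹.injective e)
  have hmap := map_tripodDist τ⁻¹ _ _ hne
  have hmap' : (Finset.univ : Finset (Fin 3)).val.map (fun i => G.edist (X r i) (X s i))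
      = ({1, 2, 3} : Multiset ℕ).map fun k : ℕ => (k : ℕ∞) := by
    rw [← hmap, Multiset.map_map]
    exact Multiset.map_congr rfl fun i _ => hval i
  refine ⟨fun e => ?_, hmap'⟩
  have h0 : (0 : ℕ∞) ∈ (Finset.univ : Finset (Fin 3)).val.map
      (fun i => G.edist (X r i) (X s i)) :=
    Multiset.mem_map.2 ⟨0, Multiset.mem_coe.2 (List.mem_finRange 0), edist_eq_zero_iff.2 (congrFun e 0)⟩
  rw [hmap'] at h0
  simp at h0

end Pattern

section LowerBound

variable {V : Type*} [Fintype V] [DecidableEq V] {G : SimpleGraph V} [DecidableRel G.Adj] {d : ℕ}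

open Classical in
theorem patternIndicator_le (Y : Fin 3 → Fin 3 → V) (τ : Equiv.Perm (Fin 3)) :
    patternIndicator G (Y 0 ∘ τ) (Y 1 ∘ τ) (Y 2 ∘ τ)
      ≤ if G.IsTripodPattern τ Y then 1 else 0 := by
  by_cases h : (G.edist (Y 0 (τ 0)) (Y 1 (τ 0)) = (2 : ℕ) ∧ G.edist (Y 0 (τ 0)) (Y 2 (τ 0)) = (3 : ℕ)
      ∧ G.edist (Y 1 (τ 0)) (Y 2 (τ 0)) = (3 : ℕ)) ∧
    (G.edist (Y 0 (τ 1)) (Y 1 (τ 1)) = (3 : ℕ) ∧ G.edist (Y 0 (τ 1)) (Y 2 (τ 1)) = (2 : ℕ)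
      ∧ G.edist (Y 1 (τ 1)) (Y 2 (τ 1)) = (1 : ℕ)) ∧
    (G.edist (Y 0 (τ 2)) (Y 1 (τ 2)) = (1 : ℕ) ∧ G.edist (Y 0 (τ 2)) (Y 2 (τ 2)) = (1 : ℕ)
      ∧ G.edist (Y 1 (τ 2)) (Y 2 (τ 2)) = (2 : ℕ))
  · have hp : G.IsTripodPattern τ Y := by
      obtain ⟨⟨a1, a2, a3⟩, ⟨b1, b2, b3⟩, c1, c2, c3⟩ := h
      have a1' := a1; have a2' := a2; have a3' := a3
      have b1' := b1; have b2' := b2; have b3' := b3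
      have c1' := c1; have c2' := c2; have c3' := c3
      rw [edist_comm] at a1' a2' a3' b1' b2' b3' c1' c2' c3'
      intro r s i
      fin_cases r <;> fin_cases s <;> fin_cases i <;>
        first
        | assumption
        | exact edist_self
    rw [if_pos hp]
    simp only [patternIndicator, distanceIndicator]
    split_ifs <;> norm_num
  · have h0 : patternIndicator G (Y 0 ∘ τ) (Y 1 ∘ τ) (Y 2 ∘ τ) = 0 := by
      simp only [patternIndicator, distanceIndicator, Function.comp_apply]
      by_contra hne
      apply h
      rw [← ne_eq, mul_ne_zero_iff, mul_ne_zero_iff] at hne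
      simp only [ne_eq, ite_eq_right_iff, one_ne_zero, imp_false, not_not] at hne
      exact ⟨hne.1.1, hne.1.2, hne.2⟩
    rw [h0]
    split_ifs <;> norm_num

open Classical in
-- Sums the pattern bound over coordinate permutations with the roles π fixed; the error 42 is 6 ·
-- 7. Moving τ from the weights onto the points replaces it by its inverse, which is harmless in the
-- sum.
theorem sum_perm_tripod_le (hg : 9 < G.egirth) (hreg : G.IsRegularOfDegree d) (hd : 0 < d)
    (A : Fin 3 → (Fin 3 → V) → ℝ) (h0 : ∀ r x, 0 ≤ A r x) (h1 : ∀ r x, A r x ≤ 1)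
    (π : Equiv.Perm (Fin 3)) :
    (d : ℝ) ^ 9 * ∑ τ : Equiv.Perm (Fin 3),
        ∑ m, tensorApply ((d : ℝ)⁻¹ • G.adjMatrix ℝ) ![1, 2, 0] (fun x => A (π 0) (x ∘ τ)) m
        * tensorApply ((d : ℝ)⁻¹ • G.adjMatrix ℝ) ![1, 1, 1] (fun x => A (π 1) (x ∘ τ)) m
        * tensorApply ((d : ℝ)⁻¹ • G.adjMatrix ℝ) ![2, 0, 1] (fun x => A (π 2) (x ∘ τ)) m
      ≤ ∑ X : Fin 3 → Fin 3 → V, (∏ r, A r (X r))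
          * (∑ τ : Equiv.Perm (Fin 3), if G.IsTripodPattern τ (X ∘ π) then (1 : ℝ) else 0)
        + 42 * (d : ℝ) ^ 8 * ∑ x, A (π 0) x := by
  have step : ∀ τ : Equiv.Perm (Fin 3),
      (d : ℝ) ^ 9 *
        ∑ m, tensorApply ((d : ℝ)⁻¹ • G.adjMatrix ℝ) ![1, 2, 0] (fun x => A (π 0) (x ∘ τ)) m
        * tensorApply ((d : ℝ)⁻¹ • G.adjMatrix ℝ) ![1, 1, 1] (fun x => A (π 1) (x ∘ τ)) m
        * tensorApply ((d : ℝ)⁻¹ • G.adjMatrix ℝ) ![2, 0, 1] (fun x => A (π 2) (x ∘ τ)) m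
      ≤ ∑ X : Fin 3 → Fin 3 → V, (∏ r, A r (X r))
          * (if G.IsTripodPattern τ⁻¹ (X ∘ π) then (1 : ℝ) else 0)
        + 7 * (d : ℝ) ^ 8 * ∑ x, A (π 0) x := by
    intro τ
    refine (tripod_sum_le_pattern_sum hg hreg hd (fun x => h0 _ _) (fun x => h0 _ _)
      (fun x => h0 _ _) (fun x => h1 _ _) (fun x => h1 _ _)).trans ?_
    rw [sum_comp_perm (A (π 0)) τ]
    refine add_le_add_left ?_ _
    have e1 : ∑ x : Fin 3 → V, ∑ y : Fin 3 → V, ∑ z : Fin 3 → V,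
        A (π 0) (x ∘ τ) * A (π 1) (y ∘ τ) * A (π 2) (z ∘ τ) * patternIndicator G x y z
        = ∑ Y : Fin 3 → Fin 3 → V, A (π 0) (Y 0) * A (π 1) (Y 1) * A (π 2) (Y 2)
          * patternIndicator G (Y 0 ∘ ⇑τ⁻¹) (Y 1 ∘ ⇑τ⁻¹) (Y 2 ∘ ⇑τ⁻¹) := by
      conv_rhs => rw [sum_pi_fin_three]
      have hc : ∀ x : Fin 3 → V, (x ∘ ⇑τ) ∘ ⇑τ⁻¹ = x := fun x => by ext i; simp
      have hs : ∀ Φ : (Fin 3 → V) → (Fin 3 → V) → (Fin 3 → V) → ℝ,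
          ∑ x, ∑ y, ∑ z, Φ (x ∘ τ) (y ∘ τ) (z ∘ τ) = ∑ x, ∑ y, ∑ z, Φ x y z := fun Φ => by
        rw [← sum_comp_perm (fun x => ∑ y, ∑ z, Φ x y z) τ]
        refine Finset.sum_congr rfl fun x _ => ?_
        rw [← sum_comp_perm (fun y => ∑ z, Φ (x ∘ τ) y z) τ]
        exact Finset.sum_congr rfl fun y _ => sum_comp_perm (fun z => Φ (x ∘ τ) (y ∘ τ) z) τ
      refine Eq.trans ?_ (hs _)
      refine Finset.sum_congr rfl fun x _ => Finset.sum_congr rfl fun y _ =>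
        Finset.sum_congr rfl fun z _ => ?_
      simp only [cons_val_zero, cons_val_one, cons_val, hc]
    rw [e1]
    have e2 : ∑ X : Fin 3 → Fin 3 → V, (∏ r, A r (X r))
          * (if G.IsTripodPattern τ⁻¹ (X ∘ π) then (1 : ℝ) else 0)
        = ∑ Y : Fin 3 → Fin 3 → V, (∏ r, A (π r) (Y r))
          * (if G.IsTripodPattern τ⁻¹ Y then (1 : ℝ) else 0) := by
      rw [← sum_comp_perm (fun Y : Fin 3 → Fin 3 → V => (∏ r, A (π r) (Y r))
          * (if G.IsTripodPattern τ⁻¹ Y then (1 : ℝ) else 0)) π]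
      refine Finset.sum_congr rfl fun X _ => ?_
      congr 1
      exact (Equiv.prod_comp π fun r => A r (X r)).symm
    rw [e2]
    refine Finset.sum_le_sum fun Y _ => ?_
    rw [Fin.prod_univ_three]
    exact mul_le_mul_of_nonneg_left (patternIndicator_le Y τ⁻¹)
      (mul_nonneg (mul_nonneg (h0 _ _) (h0 _ _)) (h0 _ _))
  rw [Finset.mul_sum]
  refine (Finset.sum_le_sum fun τ _ => step τ).trans (le_of_eq ?_)
  rw [Finset.sum_add_distrib, Finset.sum_comm]
  congr 1
  · refine Finset.sum_congr rfl fun X _ => ?_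
    rw [← Finset.mul_sum]
    congr 1
    exact Equiv.sum_comp (Equiv.inv (Equiv.Perm (Fin 3)))
      fun τ : Equiv.Perm (Fin 3) => if G.IsTripodPattern τ (X ∘ π) then (1 : ℝ) else 0
  · simp only [Finset.sum_const, Finset.card_univ, Fintype.card_perm, Fintype.card_fin,
      nsmul_eq_mul]
    rw [show ((3 : ℕ).factorial : ℝ) = 6 by norm_num [Nat.factorial]]
    ring

open Classical in
/-- Lower bound for the number of triangles of the polygraph with vertices in prescribed sets. -/
theorem polygraph_triangles_ge [Nonempty V] (hg : 9 < G.egirth) (hreg : G.IsRegularOfDegree d)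
    (hd : 0 < d) {ε : ℝ} (hε0 : 0 < ε) (hε : ε < 1) (hspec : secondEigenvalue G ≤ ε * d)
    (A : Fin 3 → (Fin 3 → V) → ℝ) (h0 : ∀ r x, 0 ≤ A r x) (h1 : ∀ r x, A r x ≤ 1)
    (a : Fin 3 → ℝ) (ha : ∀ r, finMean (A r) = a r) :
    (Fintype.card V : ℝ) ^ 3 * (d : ℝ) ^ 9 * (36 * (a 0 * a 1 * a 2)
        - (12 * ε + 16 * ε ^ 2) * (a 0 * a 1 + a 1 * a 2 + a 2 * a 0)
        - 28 * ε ^ 2 * (a 0 + a 1 + a 2))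
      ≤ ∑ X : Fin 3 → Fin 3 → V, (∏ r, A r (X r))
          * (if ∀ r s, r ≠ s → (polygraph G {1, 2, 3}).Adj (X r) (X s) then (1 : ℝ) else 0)
        + 84 * (d : ℝ) ^ 8 * ((Fintype.card V : ℝ) ^ 3 * (a 0 + a 1 + a 2)) := by
  have hK := hreg.isContracting hd hε hspec
  have hsum : ∀ r, ∑ x, A r x = (Fintype.card V : ℝ) ^ 3 * a r := fun r => by
    rw [← ha r, ← card_pi_fin_three, card_mul_finMean]
  have hpi : ∀ π : Equiv.Perm (Fin 3), _ := fun π =>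
    (mul_le_mul_of_nonneg_left (sum_perm_sum_tensorApply_mul_ge hK hε0 hε.le (h0 (π 0)) (h1 (π 0))
      (h0 (π 1)) (h1 (π 1)) (h0 (π 2)) (h1 (π 2)) (ha (π 0)) (ha (π 1)) (ha (π 2)))
      (pow_nonneg (Nat.cast_nonneg d) 9)).trans (sum_perm_tripod_le hg hreg hd A h0 h1 π)
  have htot := Finset.sum_le_sum fun π (_ : π ∈ Finset.univ) => hpi π
  rw [Finset.sum_add_distrib, Finset.sum_comm] at htot
  simp only [← Finset.mul_sum] at htot
  -- For each X at most one pair (π, τ) contributes, and any contributing pair makes X a triangle.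
  have hX : ∑ X : Fin 3 → Fin 3 → V, (∏ r, A r (X r)) * (∑ π : Equiv.Perm (Fin 3),
        ∑ τ : Equiv.Perm (Fin 3), if G.IsTripodPattern τ (X ∘ π) then (1 : ℝ) else 0)
      ≤ ∑ X : Fin 3 → Fin 3 → V, (∏ r, A r (X r))
          * (if ∀ r s, r ≠ s → (polygraph G {1, 2, 3}).Adj (X r) (X s) then (1 : ℝ) else 0) := by
    refine Finset.sum_le_sum fun X _ =>
      mul_le_mul_of_nonneg_left ?_ (Finset.prod_nonneg fun r _ => h0 r _)
    rw [← Fintype.sum_prod_type' (f := fun π τ : Equiv.Perm (Fin 3) =>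
      if G.IsTripodPattern τ (X ∘ π) then (1 : ℝ) else 0)]
    by_cases hex : ∃ p : Equiv.Perm (Fin 3) × Equiv.Perm (Fin 3),
        G.IsTripodPattern p.2 (X ∘ p.1)
    · obtain ⟨p, hp⟩ := hex
      rw [if_pos fun r s hrs => hp.adj_polygraph hrs, Finset.sum_eq_single p, if_pos hp]
      · intro q _ hq
        refine if_neg fun hq' => hq ?_
        have := hp.unique hq'
        exact Prod.ext this.1.symm this.2.symm
      · simp
    · push Not at hex
      rw [Finset.sum_eq_zero fun p _ => if_neg (hex p)]
      split_ifs <;> norm_num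
  have hA : ∑ π : Equiv.Perm (Fin 3), ∑ x, A (π 0) x
      = 2 * ((Fintype.card V : ℝ) ^ 3 * (a 0 + a 1 + a 2)) := by
    simp only [hsum]
    exact (sum_perm_fin_three fun r _ _ => (Fintype.card V : ℝ) ^ 3 * a r).trans (by ring)
  rw [hA] at htot
  -- Symmetrizing over the roles: each unordered pair occurs 4 times in the terms a_s(a_r + a_t),
  -- giving 4 + 3·4 = 16, and the linear terms give 4 + 3·8 = 28.
  have hL := sum_perm_fin_three fun r s t => 6 * (a r * a s * a t) - ε ^ 2 * (a s * (a r + a t))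
      - 2 * ε * (a r * a s + a s * a t + a t * a r) - ε ^ 2 * (a r + a t)
      - 3 * ε ^ 2 * (a r + 2 * a s + a t + a r * a s + a s * a t)
  rw [hL] at htot
  linarith

end LowerBound

end SimpleGraph

/-! ### Upper bound for the number of triangles -/

/-- The triples of permutations which may describe the distances between the vertices of a
triangle of the polygraph, as far as parity is concerned. -/
def evenTriples : Finset (Equiv.Perm (Fin 3) × Equiv.Perm (Fin 3) × Equiv.Perm (Fin 3)) :=
  {σ | ∀ i, Even ((σ.1 i : ℕ) + 1 + ((σ.2.1 i : ℕ) + 1) + ((σ.2.2 i : ℕ) + 1))}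

set_option maxRecDepth 100000 in
-- Parity forces an odd number of 2s in each coordinate. Each of the three permutations has a single
-- 2, so every coordinate has exactly one: 6 ways to place the 2s and 2³ ways to arrange the 1s and
-- 3s.
theorem card_evenTriples : evenTriples.card = 48 := by
  decide

/-- The distances from the end points of a tripod to its center, in terms of the distances between
the end points. -/
def centerLegs (a b c : ℕ) : Fin 3 → ℕ := ![(a + b - c) / 2, (a + c - b) / 2, (b + c - a) / 2]

/-- The legs at the coordinate `i`, for distances described by the permutations `σ`. -/
def permLegs (σ : Equiv.Perm (Fin 3) × Equiv.Perm (Fin 3) × Equiv.Perm (Fin 3)) (i : Fin 3) :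
    Fin 3 → ℕ :=
  centerLegs ((σ.1 i : ℕ) + 1) ((σ.2.1 i : ℕ) + 1) ((σ.2.2 i : ℕ) + 1)

set_option maxRecDepth 100000 in
theorem permLegs_add : ∀ σ ∈ evenTriples, ∀ i,
    permLegs σ i 0 + permLegs σ i 1 = (σ.1 i : ℕ) + 1 ∧
    permLegs σ i 0 + permLegs σ i 2 = (σ.2.1 i : ℕ) + 1 ∧
    permLegs σ i 1 + permLegs σ i 2 = (σ.2.2 i : ℕ) + 1 := by
  decide

set_option maxRecDepth 100000 in
-- Each coordinate has exactly one distance 2, so the pattern 2, 2, 2 with legs 1, 1, 1 cannot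
-- occur. The legs 1, 1, 2 come from the distances 2, 3, 3; in all other cases one leg is 0.
theorem permLegs_cases : ∀ σ ∈ evenTriples, ∀ i, (∃ r, permLegs σ i r = 0) ∨
    ∃ π : Equiv.Perm (Fin 3), permLegs σ i (π 0) = 1 ∧ permLegs σ i (π 1) = 1 ∧
      permLegs σ i (π 2) = 2 := by
  decide

set_option maxRecDepth 100000 in
-- The legs add up to half of all the distances, that is, to half of 3 · (1 + 2 + 3).
theorem sum_permLegs : ∀ σ ∈ evenTriples, ∑ i, ∑ r, permLegs σ i r = 9 := by
  decide

theorem exists_perm_of_map_eq {f : Fin 3 → ℕ∞}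
    (h : (Finset.univ : Finset (Fin 3)).val.map f = ({1, 2, 3} : Multiset ℕ).map fun k : ℕ => (k : ℕ∞)) :
    ∃ σ : Equiv.Perm (Fin 3), ∀ i, f i = ((σ i : ℕ) + 1 : ℕ) := by
  have hnd : ((Finset.univ : Finset (Fin 3)).val.map f).Nodup := by
    rw [h]
    exact Multiset.Nodup.map Nat.cast_injective (by decide)
  have hmem : ∀ i, ∃ j : Fin 3, f i = ((j : ℕ) + 1 : ℕ) := fun i => by
    have hi : f i ∈ (Finset.univ : Finset (Fin 3)).val.map f :=
      Multiset.mem_map_of_mem f (Finset.mem_univ i)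
    rw [h] at hi
    obtain ⟨k, hk, hki⟩ := Multiset.mem_map.1 hi
    have hk' : k = 1 ∨ k = 2 ∨ k = 3 := by simpa using hk
    rw [← hki]
    rcases hk' with rfl | rfl | rfl
    exacts [⟨0, rfl⟩, ⟨1, rfl⟩, ⟨2, rfl⟩]
  choose s hs using hmem
  have hinj : Function.Injective s := fun i j hij =>
    Multiset.inj_on_of_nodup_map hnd i (Finset.mem_univ i) j (Finset.mem_univ j)
      (by rw [hs i, hs j, hij])
  exact ⟨Equiv.ofBijective s (Finite.injective_iff_bijective.1 hinj), hs⟩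

namespace SimpleGraph

section UpperBound

variable {V : Type*} [Fintype V] [DecidableEq V] {G : SimpleGraph V} [DecidableRel G.Adj] {d : ℕ}

open Classical in
theorem IsRegularOfDegree.card_walk_le (hreg : G.IsRegularOfDegree d) (m : V) (k : ℕ) :
    (Finset.univ.filter fun u => ∃ p : G.Walk u m, p.length = k).card ≤ d ^ k := by
  induction k with
  | zero =>
    refine (Finset.card_le_card (t := {m}) fun u hu => ?_).trans (by simp)
    obtain ⟨p, hp⟩ := (Finset.mem_filter.1 hu).2
    exact Finset.mem_singleton.2 (Walk.eq_of_length_eq_zero hp)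
  | succ k ih =>
    refine (Finset.card_le_card (t := (Finset.univ.filter fun u =>
      ∃ p : G.Walk u m, p.length = k).biUnion fun w => G.neighborFinset w) fun u hu => ?_).trans ?_
    · obtain ⟨p, hp⟩ := (Finset.mem_filter.1 hu).2
      match p, hp with
      | .cons (v := w) h q, hp =>
        refine Finset.mem_biUnion.2 ⟨w, Finset.mem_filter.2 ⟨Finset.mem_univ _, q, ?_⟩, ?_⟩
        · simpa using hp
        · exact (G.mem_neighborFinset w u).2 h.symm
    · refine (Finset.card_biUnion_le_card_mul _ _ d fun w _ => (hreg w).le).trans ?_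
      rw [pow_succ]
      exact Nat.mul_le_mul_right d ih

open Classical in
theorem IsRegularOfDegree.card_sphere_le (hreg : G.IsRegularOfDegree d) (m : V) (k : ℕ) :
    (Finset.univ.filter fun u => G.edist m u = k).card ≤ d ^ k := by
  refine (Finset.card_le_card fun u hu => ?_).trans (hreg.card_walk_le m k)
  rw [Finset.mem_filter, edist_comm] at hu
  exact Finset.mem_filter.2 ⟨hu.1, exists_walk_of_edist_eq_coe hu.2⟩

/-- The triples of vertices whose distances are those of a tripod with the given legs. -/
noncomputable def tripodEnds (G : SimpleGraph V) (l : Fin 3 → ℕ) : Finset (Fin 3 → V) :=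
  open Classical in {v | ∀ r s, r ≠ s → G.edist (v r) (v s) = (l r + l s : ℕ)}

/-- An end with leg 0 is itself the center; otherwise the median is. -/
theorem exists_center (hg : 9 < G.egirth) {l : Fin 3 → ℕ} (hl : (∃ r, l r = 0) ∨
    ∃ π : Equiv.Perm (Fin 3), l (π 0) = 1 ∧ l (π 1) = 1 ∧ l (π 2) = 2)
    {v : Fin 3 → V} (hv : v ∈ tripodEnds G l) : ∃ m, ∀ r, G.edist m (v r) = l r := by
  have hv' : ∀ r s, r ≠ s → G.edist (v r) (v s) = (l r + l s : ℕ) := by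
    simpa [tripodEnds] using hv
  rcases hl with ⟨r, hr⟩ | ⟨π, h0, h1, h2⟩
  · refine ⟨v r, fun s => ?_⟩
    by_cases hrs : r = s
    · subst hrs
      rw [edist_self, hr, Nat.cast_zero]
    · rw [hv' r s hrs, hr, zero_add]
  · have hne : ∀ i j : Fin 3, i ≠ j → π i ≠ π j := fun i j h => π.injective.ne h
    have e01 := hv' _ _ (hne 0 1 (by decide))
    have e02 := hv' _ _ (hne 0 2 (by decide))
    have e12 := hv' _ _ (hne 1 2 (by decide))
    rw [h0, h1] at e01
    rw [h0, h2] at e02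
    rw [h1, h2] at e12
    obtain ⟨m, hm0, hm1, hm2⟩ := exists_median hg e01 e02 e12
    refine ⟨m, fun r => ?_⟩
    obtain ⟨i, rfl⟩ := π.surjective r
    fin_cases i
    · simpa [h0] using hm0
    · simpa [h1] using hm1
    · simpa [h2] using hm2

/-- Choose the center, then each end on the sphere of radius its leg. -/
theorem card_tripodEnds_le (hg : 9 < G.egirth) (hreg : G.IsRegularOfDegree d) {l : Fin 3 → ℕ}
    (hl : (∃ r, l r = 0) ∨
      ∃ π : Equiv.Perm (Fin 3), l (π 0) = 1 ∧ l (π 1) = 1 ∧ l (π 2) = 2) :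
    (tripodEnds G l).card ≤ Fintype.card V * d ^ ∑ r, l r := by
  classical
  refine (Finset.card_le_card (t := Finset.univ.biUnion fun m => Fintype.piFinset fun r =>
    Finset.univ.filter fun u => G.edist m u = l r) fun v hv => ?_).trans ?_
  · obtain ⟨m, hm⟩ := exists_center hg hl hv
    exact Finset.mem_biUnion.2 ⟨m, Finset.mem_univ _, Fintype.mem_piFinset.2 fun r =>
      Finset.mem_filter.2 ⟨Finset.mem_univ _, hm r⟩⟩
  · refine Finset.card_biUnion_le_card_mul _ _ _ fun m _ => ?_
    rw [Fintype.card_piFinset, ← Finset.prod_pow_eq_pow_sum]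
    exact Finset.prod_le_prod' fun r _ => hreg.card_sphere_le m (l r)

/-- The ordered triangles of the polygraph. -/
noncomputable def polygraphTriangles (G : SimpleGraph V) : Finset (Fin 3 → Fin 3 → V) :=
  open Classical in {X | ∀ r s, r ≠ s → (polygraph G {1, 2, 3}).Adj (X r) (X s)}

theorem mem_polygraphTriangles {X : Fin 3 → Fin 3 → V} : X ∈ polygraphTriangles G ↔
    ∀ r s, r ≠ s → (polygraph G {1, 2, 3}).Adj (X r) (X s) := by
  simp [polygraphTriangles]

theorem exists_evenTriple (hg : 9 < G.egirth) {X : Fin 3 → Fin 3 → V}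
    (hX : X ∈ polygraphTriangles G) :
    ∃ σ ∈ evenTriples, ∀ i, (fun r => X r i) ∈ tripodEnds G (permLegs σ i) := by
  have hX' := mem_polygraphTriangles.1 hX
  obtain ⟨σ₀, h0⟩ := exists_perm_of_map_eq (hX' 0 1 (by decide)).2
  obtain ⟨σ₁, h1⟩ := exists_perm_of_map_eq (hX' 0 2 (by decide)).2
  obtain ⟨σ₂, h2⟩ := exists_perm_of_map_eq (hX' 1 2 (by decide)).2
  have hmem : (σ₀, σ₁, σ₂) ∈ evenTriples := by
    refine Finset.mem_filter.2 ⟨Finset.mem_univ _, fun i => ?_⟩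
    refine even_of_edist_eq hg (h0 i) (h1 i) (h2 i) ?_
    have := (σ₀ i).isLt
    have := (σ₁ i).isLt
    have := (σ₂ i).isLt
    simp only
    omega
  refine ⟨_, hmem, fun i => ?_⟩
  obtain ⟨e0, e1, e2⟩ := permLegs_add _ hmem i
  have h0' : G.edist (X 0 i) (X 1 i) = _ := (h0 i).trans (congrArg Nat.cast e0.symm)
  have h1' : G.edist (X 0 i) (X 2 i) = _ := (h1 i).trans (congrArg Nat.cast e1.symm)
  have h2' : G.edist (X 1 i) (X 2 i) = _ := (h2 i).trans (congrArg Nat.cast e2.symm)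
  refine Finset.mem_filter.2 ⟨Finset.mem_univ _, fun r s hrs => ?_⟩
  fin_cases r <;> fin_cases s <;>
    first
    | exact absurd rfl hrs
    | assumption
    | (rw [edist_comm, add_comm]; assumption)

/-- For each of the 48 patterns the coordinates are independent, each contributing a center and its
legs; the leg lengths total 9. -/
theorem card_polygraphTriangles_le (hg : 9 < G.egirth) (hreg : G.IsRegularOfDegree d) :
    (polygraphTriangles G).card ≤ 48 * (Fintype.card V ^ 3 * d ^ 9) := by
  classical
  rw [← card_evenTriples]
  refine (Finset.card_le_card (t := evenTriples.biUnion fun σ =>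
    Finset.univ.filter fun X : Fin 3 → Fin 3 → V =>
      ∀ i, (fun r => X r i) ∈ tripodEnds G (permLegs σ i)) fun X hX => ?_).trans
    (Finset.card_biUnion_le_card_mul _ _ _ fun σ hσ => ?_)
  · obtain ⟨σ, hσ, h⟩ := exists_evenTriple hg hX
    exact Finset.mem_biUnion.2 ⟨σ, hσ, Finset.mem_filter.2 ⟨Finset.mem_univ _, h⟩⟩
  · calc _ ≤ (Fintype.piFinset fun i => tripodEnds G (permLegs σ i)).card := by
          refine Finset.card_le_card_of_injOn (fun X i r => X r i) (fun X hX => ?_)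
            fun X _ Y _ h => ?_
          · exact Finset.mem_coe.2 (Fintype.mem_piFinset.2
              (Finset.mem_filter.1 (Finset.mem_coe.1 hX)).2)
          · funext r i
            exact congrFun (congrFun h i) r
      _ = ∏ i, (tripodEnds G (permLegs σ i)).card := Fintype.card_piFinset _
      _ ≤ ∏ i, Fintype.card V * d ^ ∑ r, permLegs σ i r :=
          Finset.prod_le_prod' fun i _ => card_tripodEnds_le hg hreg (permLegs_cases σ hσ i)
      _ = Fintype.card V ^ 3 * d ^ 9 := by
          rw [Finset.prod_mul_distrib, Finset.prod_const, Finset.prod_pow_eq_pow_sum,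
            sum_permLegs σ hσ, Finset.card_univ, Fintype.card_fin]

end UpperBound

end SimpleGraph

/-! ### Ordered triangles and faces of the clique complex -/

section TwoFaces

variable {W : Type*} [Fintype W] [DecidableEq W]

theorem range_mem_twoFaces_cliqueComplex {H : SimpleGraph W} {X : Fin 3 → W}
    (hX : ∀ r s, r ≠ s → H.Adj (X r) (X s)) :
    Finset.univ.image X ∈ twoFaces (cliqueComplex H) := by
  have hinj : Function.Injective X := fun r s h => by
    by_contra hrs
    exact (hX r s hrs).ne h
  refine ⟨⟨⟨X 0, Finset.mem_image_of_mem X (Finset.mem_univ 0)⟩, ?_⟩, ?_⟩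
  · intro u hu v hv huv
    obtain ⟨r, -, rfl⟩ := Finset.mem_image.1 (Finset.mem_coe.1 hu)
    obtain ⟨s, -, rfl⟩ := Finset.mem_image.1 (Finset.mem_coe.1 hv)
    exact hX r s fun h => huv (congrArg X h)
  · rw [Finset.card_image_of_injective _ hinj, Finset.card_univ, Fintype.card_fin]

open Classical in
-- Every face has six orderings, and distinct pairs of a face and an ordering give distinct triples.
theorem six_mul_ncard_twoFaces_le (H : SimpleGraph W) :
    6 * (twoFaces (cliqueComplex H)).ncard
      ≤ (Finset.univ.filter fun X : Fin 3 → W => ∀ r s, r ≠ s → H.Adj (X r) (X s)).card := by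
  have hF : ∀ F : twoFaces (cliqueComplex H), ∃ X : Fin 3 → W, Function.Injective X ∧
      Finset.univ.image X = F.1 := fun F => by
    refine ⟨fun r => (F.1.equivFinOfCardEq F.2.2).symm r, fun r s h => ?_, ?_⟩
    · exact (F.1.equivFinOfCardEq F.2.2).symm.injective (Subtype.ext h)
    · ext w
      simp only [Finset.mem_image, Finset.mem_univ, true_and]
      constructor
      · rintro ⟨r, rfl⟩
        exact ((F.1.equivFinOfCardEq F.2.2).symm r).2
      · exact fun hw => ⟨F.1.equivFinOfCardEq F.2.2 ⟨w, hw⟩, by simp⟩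
  choose X hXinj hXF using hF
  have himage : ∀ F (π : Equiv.Perm (Fin 3)), Finset.univ.image (X F ∘ π) = F.1 := fun F π => by
    rw [← Finset.image_image, Finset.image_univ_equiv, hXF]
  have hcard : 6 * (twoFaces (cliqueComplex H)).ncard
      = Fintype.card (Equiv.Perm (Fin 3) × twoFaces (cliqueComplex H)) := by
    rw [Fintype.card_prod, Fintype.card_perm, Fintype.card_fin, ← Nat.card_eq_fintype_card,
      Nat.card_coe_set_eq]
    rfl
  rw [hcard, ← Finset.card_univ]
  refine Finset.card_le_card_of_injOn (fun p => X p.2 ∘ p.1) (fun p _ => ?_) ?_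
  · refine Finset.mem_coe.2 (Finset.mem_filter.2 ⟨Finset.mem_univ _, fun r s hrs => ?_⟩)
    refine p.2.2.1.2 ?_ ?_ ((hXinj p.2).ne (p.1.injective.ne hrs)) <;>
    · rw [← hXF p.2]
      exact Finset.mem_coe.2 (Finset.mem_image_of_mem _ (Finset.mem_univ _))
  · rintro ⟨π, F⟩ - ⟨ρ, F'⟩ - h
    have hFF : F = F' := Subtype.ext (by
      rw [← himage F π, ← himage F' ρ]; exact congrArg (fun Y : Fin 3 → W => Finset.univ.image Y) h)
    subst hFF
    refine Prod.ext (Equiv.ext fun r => hXinj F (congrFun h r)) rfl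

end TwoFaces

section Faces

variable {W : Type*} [Fintype W] [DecidableEq W]

open Classical in
-- Since the six sets are disjoint, a face determines its family and the order of its vertices, so
-- here ordered triples count faces without a factor 6.
theorem sum_card_triangles_le_ncard (H : SimpleGraph W) (f : W → EuclideanSpace ℝ (Fin 2))
    (p : EuclideanSpace ℝ (Fin 2)) (T : Fin 2 × Fin 3 → Finset W)
    (hT : Pairwise fun i j => Disjoint (T i) (T j))
    (hp : ∀ b, ∀ x ∈ T (b, 0), ∀ y ∈ T (b, 1), ∀ z ∈ T (b, 2),
      p ∈ convexHull ℝ {f x, f y, f z}) :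
    ∑ b, (Finset.univ.filter fun X : Fin 3 → W =>
        (∀ r, X r ∈ T (b, r)) ∧ ∀ r s, r ≠ s → H.Adj (X r) (X s)).card
      ≤ {s | s ∈ twoFaces (cliqueComplex H) ∧
          p ∈ convexHull ℝ (f '' (s : Set W))}.ncard := by
  have hinj : ∀ {X Y : Fin 3 → W} {b b' : Fin 2}, (∀ r, X r ∈ T (b, r)) →
      (∀ r, Y r ∈ T (b', r)) → Finset.univ.image X = Finset.univ.image Y → b = b' ∧ X = Y := by
    intro X Y b b' hX hY hXY
    have key : ∀ r, b = b' ∧ X r = Y r := fun r => by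
      obtain ⟨s, -, hs⟩ := Finset.mem_image.1
        (hXY ▸ Finset.mem_image_of_mem X (Finset.mem_univ r) : X r ∈ Finset.univ.image Y)
      have hbr : (b, r) = (b', s) := by
        by_contra hne
        exact Finset.disjoint_left.1 (hT hne) (hX r) (hs ▸ hY s)
      obtain ⟨rfl, rfl⟩ := Prod.ext_iff.1 hbr
      exact ⟨rfl, hs.symm⟩
    exact ⟨(key 0).1, funext fun r => (key r).2⟩
  rw [← Finset.card_biUnion, Set.ncard_eq_toFinset_card']
  · refine Finset.card_le_card_of_injOn (fun X => Finset.univ.image X) (fun X hX => ?_) ?_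
    · obtain ⟨b, -, hb⟩ := Finset.mem_biUnion.1 (Finset.mem_coe.1 hX)
      obtain ⟨-, hXT, hadj⟩ := Finset.mem_filter.1 hb
      refine Finset.mem_coe.2 (Set.mem_toFinset.2 ⟨range_mem_twoFaces_cliqueComplex hadj, ?_⟩)
      have h3 : f '' ((Finset.univ.image X : Finset W) : Set W)
          = {f (X 0), f (X 1), f (X 2)} := by
        ext q
        simp [Fin.exists_fin_succ, eq_comm]
      rw [h3]
      exact hp b _ (hXT 0) _ (hXT 1) _ (hXT 2)
    · intro X hX Y hY hXY
      obtain ⟨b, -, hb⟩ := Finset.mem_biUnion.1 (Finset.mem_coe.1 hX)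
      obtain ⟨b', -, hb'⟩ := Finset.mem_biUnion.1 (Finset.mem_coe.1 hY)
      exact (hinj (Finset.mem_filter.1 hb).2.1 (Finset.mem_filter.1 hb').2.1 hXY).2
  · intro b _ b' _ hbb
    refine Finset.disjoint_left.2 fun X hX hX' => hbb ?_
    exact (hinj (Finset.mem_filter.1 hX).2.1 (Finset.mem_filter.1 hX').2.1 rfl).1

end Faces

namespace SimpleGraph

variable {V : Type*} [Fintype V] [DecidableEq V] {G : SimpleGraph V} [DecidableRel G.Adj] {d : ℕ}

open Classical in
theorem card_polygraph_triangles_ge [Nonempty V] (hg : 9 < G.egirth)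
    (hreg : G.IsRegularOfDegree d) (hd : 0 < d) {ε : ℝ} (hε0 : 0 < ε) (hε : ε < 1)
    (hspec : secondEigenvalue G ≤ ε * d) (T : Fin 3 → Finset (Fin 3 → V)) (a : Fin 3 → ℝ)
    (ha : ∀ r, ((T r).card : ℝ) = (Fintype.card V : ℝ) ^ 3 * a r) :
    (Fintype.card V : ℝ) ^ 3 * (d : ℝ) ^ 9 * (36 * (a 0 * a 1 * a 2)
        - (12 * ε + 16 * ε ^ 2) * (a 0 * a 1 + a 1 * a 2 + a 2 * a 0)
        - 28 * ε ^ 2 * (a 0 + a 1 + a 2))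
      ≤ ((Finset.univ.filter fun X : Fin 3 → Fin 3 → V => (∀ r, X r ∈ T r) ∧
          ∀ r s, r ≠ s → (polygraph G {1, 2, 3}).Adj (X r) (X s)).card : ℝ)
        + 84 * (d : ℝ) ^ 8 * ((Fintype.card V : ℝ) ^ 3 * (a 0 + a 1 + a 2)) := by
  have hV : (Fintype.card V : ℝ) ^ 3 ≠ 0 := by
    have : (Fintype.card V : ℝ) ≠ 0 := by exact_mod_cast Fintype.card_ne_zero
    positivity
  have hcard : (Fintype.card (Fin 3 → V) : ℝ) = (Fintype.card V : ℝ) ^ 3 := by simp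
  refine (polygraph_triangles_ge hg hreg hd hε0 hε hspec (fun r x => if x ∈ T r then 1 else 0)
    (fun r x => by split_ifs <;> norm_num) (fun r x => by split_ifs <;> norm_num) a
    fun r => ?_).trans (le_of_eq ?_)
  · rw [finMean, Finset.sum_boole, hcard, Finset.filter_univ_mem, ha, mul_div_cancel_left₀ _ hV]
  · congr 1
    rw [← Finset.sum_boole]
    refine Finset.sum_congr rfl fun X _ => ?_
    simp only [Finset.prod_boole, ite_zero_mul_ite_zero, mul_one, Finset.mem_univ, true_implies]

end SimpleGraph

/-! ### Constants and conclusion -/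

/-- The two families are worst when balanced, σ = τ = κ: the deviation enters as (72κ − 1.28)(σ −
κ)², which is nonnegative. What remains is 72κ³ − 3.84κ² − 0.735κ for κ close to 1/6, where 0.735 =
0.42 + 6·84/1600. -/
theorem overlap_density_ge {κ σ τ δ : ℝ} (hκ : 0.166 ≤ κ) (hκ' : κ ≤ 1 / 6) (hst : σ + τ = 2 * κ)
    (hδ : δ ≤ 84 / 1600) :
    0.08 ≤ (36 * (κ * σ * σ) - (12 * (1 / 20) + 16 * (1 / 20) ^ 2) * (κ * σ + σ * σ + σ * κ)
        - 28 * (1 / 20) ^ 2 * (κ + σ + σ))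
      + (36 * (κ * τ * τ) - (12 * (1 / 20) + 16 * (1 / 20) ^ 2) * (κ * τ + τ * τ + τ * κ)
        - 28 * (1 / 20) ^ 2 * (κ + τ + τ)) - δ * (6 * κ) := by
  obtain rfl : τ = 2 * κ - σ := by linarith
  have h1 : 0 ≤ (72 * κ - 1.28) * (σ - κ) ^ 2 :=
    mul_nonneg (by linarith) (sq_nonneg _)
  have h2 : 0.08 ≤ 72 * κ ^ 3 - 3.84 * κ ^ 2 - 0.735 * κ := by
    have h3 : (0.166 : ℝ) ^ 2 ≤ κ ^ 2 := pow_le_pow_left₀ (by norm_num) hκ 2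
    have h4 : 0 ≤ κ * (72 * κ ^ 2 - 3.84 * κ - 0.735 - 0.6) :=
      mul_nonneg (by linarith) (by norm_num at h3; linarith)
    nlinarith
  have h5 : δ * (6 * κ) ≤ 84 / 1600 * (6 * κ) := mul_le_mul_of_nonneg_right hδ (by linarith)
  nlinarith

theorem pairwise_disjoint_of_list {W : Type*} {S₁ S₂ S₃ S₄ S₅ S₆ : Finset W}
    (h : [S₁, S₂, S₃, S₄, S₅, S₆].Pairwise Disjoint) :
    Pairwise fun i j : Fin 2 × Fin 3 =>
      Disjoint ((![![S₁, S₃, S₅], ![S₄, S₂, S₆]] : Fin 2 → Fin 3 → Finset W) i.1 i.2)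
        ((![![S₁, S₃, S₅], ![S₄, S₂, S₆]] : Fin 2 → Fin 3 → Finset W) j.1 j.2) := by
  simp only [List.pairwise_cons, List.mem_cons, List.not_mem_nil, or_false, forall_eq_or_imp,
    forall_eq] at h
  obtain ⟨⟨h12, h13, h14, h15, h16⟩, ⟨h23, h24, h25, h26⟩, ⟨h34, h35, h36⟩, ⟨h45, h46⟩, h56, -⟩ := h
  rintro ⟨b, r⟩ ⟨b', r'⟩ hne
  fin_cases b <;> fin_cases r <;> fin_cases b' <;> fin_cases r' <;>
    first
    | exact absurd rfl hne
    | assumption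
    | (apply Disjoint.symm; assumption)

theorem mainTheorem4 {V : Type*} [Fintype V] [DecidableEq V]
    (G : SimpleGraph V) [DecidableRel G.Adj] (d : ℕ)
    (hreg : G.IsRegularOfDegree d) (hgirth : 9 < G.egirth)
    (hd : 1600 < d) (hspec : secondEigenvalue G < (1 / 20 : ℝ) * d) :
    HasGeometricOverlap (cliqueComplex (polygraph G {1, 2, 3})) (1 / 100) := by
  classical
  intro f hf
  -- The index type of the polygraph on {1, 2, 3} reduces definitionally to `Fin 3`.
  change (Fin 3 → V) → EuclideanSpace ℝ (Fin 2) at f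
  have hupper : 6 * (twoFaces (cliqueComplex (polygraph G {1, 2, 3}))).ncard
      ≤ 48 * (Fintype.card V ^ 3 * d ^ 9) :=
    ((six_mul_ncard_twoFaces_le (W := Fin 3 → V) (polygraph G {1, 2, 3})).trans
      (le_of_eq (by rw [SimpleGraph.polygraphTriangles]))).trans
      (SimpleGraph.card_polygraphTriangles_le hgirth hreg)
  rcases isEmpty_or_nonempty V with hV | hV
  · refine ⟨0, ?_⟩
    have h0 : (twoFaces (cliqueComplex (polygraph G {1, 2, 3}))).ncard = 0 := by
      simpa using hupper
    rw [h0]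
    simp
  have hn : 1602 ≤ Fintype.card V := by
    have x : V := Classical.arbitrary V
    have := G.degree_lt_card_verts x
    rw [hreg x] at this
    omega
  have hd0 : 0 < d := by omega
  have hN : Fintype.card (Fin 3 → V) = Fintype.card V ^ 3 := by simp
  -- Rounding down costs at most 1/N in k/N; since N ≥ 10000, k/N stays above 0.166.
  set k := Fintype.card V ^ 3 / 6 with hk
  have hNlarge : 10000 ≤ Fintype.card V ^ 3 :=
    le_trans (by norm_num) (Nat.pow_le_pow_left hn 3)
  obtain ⟨p, S₁, S₂, S₃, S₄, S₅, S₆, h1, h4, h23, h36, h56, hdisj, hp, hp'⟩ :=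
    exists_six_sectors f hf k (by omega) (by rw [hN]; omega)
  refine ⟨p, ?_⟩
  have hlower := sum_card_triangles_le_ncard (polygraph G {1, 2, 3}) f p
    (fun i => (![![S₁, S₃, S₅], ![S₄, S₂, S₆]] : Fin 2 → Fin 3 → Finset (Fin 3 → V)) i.1 i.2)
    (pairwise_disjoint_of_list hdisj) (fun b => by
      fin_cases b
      · exact hp
      · exact hp')
  rw [Fin.sum_univ_two] at hlower
  set N : ℝ := (Fintype.card V : ℝ) ^ 3 with hNdef
  have hNR : ((Fintype.card V ^ 3 : ℕ) : ℝ) = N := by push_cast; rfl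
  have hNpos : 10000 ≤ N := by rw [← hNR]; exact_mod_cast hNlarge
  have hkle : 6 * (k : ℝ) ≤ N := by
    rw [← hNR]; exact_mod_cast (show 6 * k ≤ Fintype.card V ^ 3 by omega)
  have hkge : N ≤ 6 * (k : ℝ) + 6 := by
    rw [← hNR]; exact_mod_cast (show Fintype.card V ^ 3 ≤ 6 * k + 6 by omega)
  have hN0 : N ≠ 0 := by linarith
  have hcardeq : ∀ m : ℕ, (m : ℝ) = N * (m / N) := fun m => (mul_div_cancel₀ _ hN0).symm
  have key := fun T a ha => SimpleGraph.card_polygraph_triangles_ge hgirth hreg hd0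
    (ε := 1 / 20) (by norm_num) (by norm_num) hspec.le T a ha
  -- The size relations force |S₅| = |S₃|, and likewise |S₆| = |S₂| below, so each family has
  -- densities of the form κ, σ, σ.
  have hA := key ![S₁, S₃, S₅] ![k / N, S₃.card / N, S₃.card / N] (by
    have h5 : S₅.card = S₃.card := by omega
    intro r
    fin_cases r
    · simpa [h1] using hcardeq k
    · simpa using hcardeq S₃.card
    · simpa [h5] using hcardeq S₃.card)
  have hB := key ![S₄, S₂, S₆] ![k / N, S₂.card / N, S₂.card / N] (by
    have h6 : S₆.card = S₂.card := by omega
    intro r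
    fin_cases r
    · simpa [h4] using hcardeq k
    · simpa using hcardeq S₂.card
    · simpa [h6] using hcardeq S₂.card)
  simp only [cons_val_zero, cons_val_one, cons_val] at hA hB
  have hst : (S₃.card : ℝ) / N + S₂.card / N = 2 * (k / N) := by
    rw [← add_div, add_comm, ← mul_div_assoc]
    exact_mod_cast congrArg (fun m : ℕ => (m : ℝ) / N) h23
  have hdR : (1600 : ℝ) ≤ d := by exact_mod_cast hd.le
  have hdens := overlap_density_ge (κ := k / N) (δ := 84 / d)
    (by rw [le_div_iff₀ (by linarith)]; linarith)
    (by rw [div_le_iff₀ (by linarith)]; linarith) hst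
    (div_le_div_of_nonneg_left (by norm_num) (by norm_num) hdR)
  have hscale := mul_le_mul_of_nonneg_left hdens
    (show 0 ≤ N * (d : ℝ) ^ 9 by positivity)
  have h8 : 84 * (d : ℝ) ^ 8 = d ^ 9 * (84 / d) := by
    field_simp
  rw [h8] at hA hB
  have hupperR : 6 * ((twoFaces (cliqueComplex (polygraph G {1, 2, 3}))).ncard : ℝ)
      ≤ 48 * (N * d ^ 9) := by
    rw [← hNR]; exact_mod_cast hupper
  have hlowerR := (Nat.cast_le (α := ℝ)).2 hlower
  rw [Nat.cast_add] at hlowerR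
  refine le_trans ?_ hlowerR
  refine le_trans ?_ (add_le_add (sub_le_iff_le_add.2 hA) (sub_le_iff_le_add.2 hB))
  -- There are at most 8·N·d⁹ faces in all, and 8/100 = 0.08.
  refine le_trans (b := N * (d : ℝ) ^ 9 * 0.08) (by linarith) (hscale.trans (le_of_eq ?_))
  linear_combination N * (d : ℝ) ^ 9 * (84 / d) * 2 * hst
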